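/- For a topological group $G$, let $\hat G^L$ denote its left completion, i.e. the Hausdorff completion of $G$ with respect to the left uniform structure, whose basic entourages are $\{(g,h)\colon g^{-1}h\in V\}$, $V$ a neighbourhood of the identity. Each left translation $h\mapsto gh$ extends uniquely to a continuous map $z\mapsto gz$ of $\hat G^L$, and the stabilizer of $z\in\hat G^L$ is $\{g\in G\colon gz=z\}$. An action of $G$ on a space $X$ is *proper* if the inverse images of compact sets under the map $G\times X\to X\times X$, $(g,x)\mapsto (gx,x)$, are compact, and *free* if $gx=x$ for some $x\in X$ implies $g=1$. An action is *continuous* if the map $G\times X\to X$ is jointly continuous. A *Urysohn space* $\mathbb U$ is a complete separable metric space into which every separable metric space embeds isometrically and such that every isometry between finite subspaces of $\mathbb U$ extends to an isometry of $\mathbb U$ onto itself. Such a space exists (it is unique up to isometry). Write $\mathbb U_1$ for a sphere $\{x\in\mathbb U\colon d(x,c)=r\}$, where $c\in\mathbb U$ and $r>0$ are arbitrary (for $r=1/2$ this is the Urysohn space of diameter $1$). **Theorem.** Let $G$ be any of the following groups: 1. the unitary group $U(\ell^2)$ of the complex Hilbert space $\ell^2$, with the strong operator topology; 2. the group $S_\infty$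 of all permutations of $\mathbb N$, with the topology of pointwise convergence on the discrete set $\mathbb N$; 3. the group $\mathrm{Iso}(\mathbb U_1)$ of all isometries of $\mathbb U_1$ onto itself, with the topology of pointwise convergence; 4. the group $\mathrm{Homeo}_+[0,1]$ of endpoint-preserving homeomorphisms of $[0,1]$, with the compact-open topology. Then $G$ is a Polish group, and there is an element $z\in\hat G^L$ whose stabilizer in $G$ is non-compact. Moreover, no continuous action of $G$ by isometries on a non-empty complete metric space is proper, and no such action is free. In particular, no continuous action of $G$ by affine isometries on a Banach space is proper, and no such action is free. -/

import Mathlib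

open Topology Filter

universe u v

/-! ### Actions of topological groups -/

/-- The left completion of a topological group: the (Hausdorff) completion with respect to the left
uniform structure, whose basic entourages are `{(g, h) | g⁻¹ * h ∈ V}`, `V` a neighbourhood of `1`. -/
abbrev LeftCompletion (G : Type u) [Group G] [TopologicalSpace G] [IsTopologicalGroup G] : Type u :=
  letI : UniformSpace G := IsTopologicalGroup.leftUniformSpace G
  UniformSpace.Completion G

/-- Left translations are uniformly continuous for the left uniform structure. -/
theorem uniformContinuous_leftTranslation (G : Type u) [Group G] [TopologicalSpace G]
    [IsTopologicalGroup G] (g : G) :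
    letI : UniformSpace G := IsTopologicalGroup.leftUniformSpace G
    UniformContinuous (fun h : G => g * h) := by
  let _ : UniformSpace G := IsTopologicalGroup.leftUniformSpace G
  have e : uniformity G = comap (fun p : G × G => p.1⁻¹ * p.2) (𝓝 1) := rfl
  unfold UniformContinuous
  rw [e, tendsto_comap_iff]
  refine tendsto_comap.congr fun p => ?_
  simp [mul_assoc]

/-- Multiplication on the left by `g : G` on the left completion of `G`: the unique continuous
extension of the left translation `h ↦ g * h`. -/
noncomputable def leftMulCompletion {G : Type u} [Group G] [TopologicalSpace G]
    [IsTopologicalGroup G] (g : G) : LeftCompletion G → LeftCompletion G :=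
  letI : UniformSpace G := IsTopologicalGroup.leftUniformSpace G
  UniformSpace.Completion.map (fun h : G => g * h)

/-- Some element of the left completion of `G` has a non-compact stabilizer in `G`
(with respect to left multiplication). -/
def HasNoncompactStabilizer (G : Type u) [Group G] [TopologicalSpace G]
    [IsTopologicalGroup G] : Prop :=
  ∃ z : LeftCompletion G, ¬ IsCompact {g : G | leftMulCompletion g z = z}

/-- An action `a : G → X → X` is (topologically) proper if the inverse images of compact sets under
the map `G × X → X × X`, `(g, x) ↦ (g x, x)`, are compact. -/
def IsProperAction {G : Type u} {X : Type v} [TopologicalSpace G] [TopologicalSpace X]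
    (a : G → X → X) : Prop :=
  ∀ K : Set (X × X), IsCompact K →
    IsCompact ((fun p : G × X => (a p.1 p.2, p.2)) ⁻¹' K)

/-- An action is free if only the identity of the group fixes a point. -/
def IsFreeAction {G : Type u} {X : Type v} [Group G] (a : G → X → X) : Prop :=
  ∀ (g : G) (x : X), a g x = x → g = 1

/-- No (jointly) continuous action of `G` by isometries on a non-empty complete metric space
is proper, and none is free. -/
def NoProperOrFreeIsometricAction (G : Type u) [Group G] [TopologicalSpace G] : Prop :=
  ∀ (X : Type v) [MetricSpace X] [CompleteSpace X] [Nonempty X] (π : G →* (X ≃ᵢ X)),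
    Continuous (fun p : G × X => π p.1 p.2) →
      ¬ IsProperAction (fun g x => π g x) ∧ ¬ IsFreeAction (fun g x => π g x)

/-- No (jointly) continuous action of `G` by affine isometries on a Banach space is proper,
and none is free. -/
def NoProperOrFreeAffineIsometricAction (G : Type u) [Group G] [TopologicalSpace G] : Prop :=
  ∀ (E : Type v) [NormedAddCommGroup E] [NormedSpace ℝ E] [CompleteSpace E]
    (π : G →* (E ≃ᵃⁱ[ℝ] E)),
    Continuous (fun p : G × E => π p.1 p.2) →
      ¬ IsProperAction (fun g x => π g x) ∧ ¬ IsFreeAction (fun g x => π g x)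

/-! ### Groups of isometries with the topology of pointwise convergence -/

/-- The topology of pointwise convergence on the group of isometries of a metric space. -/
instance IsometryEquiv.pointwiseTopology (X : Type u) [MetricSpace X] :
    TopologicalSpace (X ≃ᵢ X) :=
  TopologicalSpace.induced (fun g : X ≃ᵢ X => (g : X → X)) inferInstance

theorem IsometryEquiv.tendsto_pointwise {X : Type u} [MetricSpace X] {ι : Type v} {l : Filter ι}
    {f : ι → (X ≃ᵢ X)} {g : X ≃ᵢ X} :
    Tendsto f l (𝓝 g) ↔ ∀ x, Tendsto (fun i => f i x) l (𝓝 (g x)) := by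
  rw [nhds_induced, tendsto_comap_iff, tendsto_pi_nhds]
  rfl

instance IsometryEquiv.isTopologicalGroup_pointwise (X : Type u) [MetricSpace X] :
    IsTopologicalGroup (X ≃ᵢ X) where
  continuous_mul := by
    rw [continuous_iff_continuousAt]
    rintro ⟨g, h⟩
    refine IsometryEquiv.tendsto_pointwise.2 fun x => ?_
    have h1 := IsometryEquiv.tendsto_pointwise.1
      (continuous_fst.tendsto (g, h) : Tendsto Prod.fst (𝓝 (g, h)) (𝓝 g)) (h x)
    have h2 := IsometryEquiv.tendsto_pointwise.1
      (continuous_snd.tendsto (g, h) : Tendsto Prod.snd (𝓝 (g, h)) (𝓝 h)) x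
    rw [tendsto_iff_dist_tendsto_zero] at h1 h2 ⊢
    refine squeeze_zero (fun _ => dist_nonneg) (fun p => ?_) (by simpa using h2.add h1)
    calc dist ((p.1 * p.2) x) ((g * h) x)
        ≤ dist (p.1 (p.2 x)) (p.1 (h x)) + dist (p.1 (h x)) (g (h x)) := dist_triangle _ _ _
      _ = dist (p.2 x) (h x) + dist (p.1 (h x)) (g (h x)) := by rw [p.1.dist_eq]
  continuous_inv := by
    rw [continuous_iff_continuousAt]
    intro g
    refine IsometryEquiv.tendsto_pointwise.2 fun x => ?_
    have h1 := IsometryEquiv.tendsto_pointwise.1 (tendsto_id : Tendsto id (𝓝 g) (𝓝 g)) (g.symm x)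
    rw [tendsto_iff_dist_tendsto_zero] at h1 ⊢
    refine h1.congr fun p => ?_
    have : dist (p⁻¹ x) (g⁻¹ x) = dist (p (p.symm x)) (p (g.symm x)) := (p.dist_eq _ _).symm
    rw [this, p.apply_symm_apply, dist_comm, id, g.apply_symm_apply]

/-! ### The unitary group of `ℓ²` -/

/-- The complex Hilbert space `ℓ²`. -/
abbrev EllTwo : Type := lp (fun _ : ℕ => ℂ) 2

/-- The group `U(ℓ²)` of all unitary operators (surjective linear isometries) of `ℓ²`. -/
abbrev UnitaryEllTwo : Type := EllTwo ≃ₗᵢ[ℂ] EllTwo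

/-- The strong operator topology: pointwise norm convergence on `ℓ²`. -/
noncomputable instance UnitaryEllTwo.strongTopology : TopologicalSpace UnitaryEllTwo :=
  TopologicalSpace.induced (fun g : UnitaryEllTwo => (g : EllTwo → EllTwo)) inferInstance

instance UnitaryEllTwo.isTopologicalGroup : IsTopologicalGroup UnitaryEllTwo := by
  let φ : UnitaryEllTwo →* (EllTwo ≃ᵢ EllTwo) :=
    { toFun := fun g => g.toIsometryEquiv
      map_one' := rfl
      map_mul' := fun _ _ => rfl }
  have e : UnitaryEllTwo.strongTopology =
      TopologicalSpace.induced φ (IsometryEquiv.pointwiseTopology EllTwo) := by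
    unfold UnitaryEllTwo.strongTopology IsometryEquiv.pointwiseTopology
    rw [induced_compose]
    rfl
  rw [e]
  exact topologicalGroup_induced φ

/-! ### The infinite symmetric group -/

/-- The topology on `S_∞ = Equiv.Perm ℕ` of pointwise convergence on the discrete space `ℕ`. -/
instance SInfty.pointwiseTopology : TopologicalSpace (Equiv.Perm ℕ) :=
  TopologicalSpace.induced (fun σ : Equiv.Perm ℕ => (σ : ℕ → ℕ)) inferInstance

theorem SInfty.tendsto_pointwise {ι : Type v} {l : Filter ι}
    {f : ι → Equiv.Perm ℕ} {σ : Equiv.Perm ℕ} :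
    Tendsto f l (𝓝 σ) ↔ ∀ n, ∀ᶠ i in l, f i n = σ n := by
  rw [nhds_induced, tendsto_comap_iff, tendsto_pi_nhds]
  simp [nhds_discrete, tendsto_pure]

instance SInfty.isTopologicalGroup : IsTopologicalGroup (Equiv.Perm ℕ) where
  continuous_mul := by
    rw [continuous_iff_continuousAt]
    rintro ⟨σ, τ⟩
    refine SInfty.tendsto_pointwise.2 fun n => ?_
    filter_upwards [SInfty.tendsto_pointwise.1
      (continuous_fst.tendsto (σ, τ) : Tendsto Prod.fst (𝓝 (σ, τ)) (𝓝 σ)) (τ n),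
      SInfty.tendsto_pointwise.1
      (continuous_snd.tendsto (σ, τ) : Tendsto Prod.snd (𝓝 (σ, τ)) (𝓝 τ)) n] with p h1 h2
    simp [h1, h2]
  continuous_inv := by
    rw [continuous_iff_continuousAt]
    intro σ
    refine SInfty.tendsto_pointwise.2 fun n => ?_
    filter_upwards [SInfty.tendsto_pointwise.1 (tendsto_id : Tendsto id (𝓝 σ) (𝓝 σ)) (σ⁻¹ n)]
      with p h
    rw [Equiv.Perm.inv_eq_iff_eq]
    simpa using h.symm

/-! ### The group of homeomorphisms of the unit interval -/

/-- `Homeo₊[0,1]`: the group of endpoint-preserving homeomorphisms of `[0,1]`. -/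
def HomeoPlus : Subgroup (unitInterval ≃ₜ unitInterval) where
  carrier := {f | f 0 = 0 ∧ f 1 = 1}
  one_mem' := ⟨rfl, rfl⟩
  mul_mem' := by
    rintro f g ⟨hf0, hf1⟩ ⟨hg0, hg1⟩
    exact ⟨(congrArg f hg0).trans hf0, (congrArg f hg1).trans hf1⟩
  inv_mem' := by
    rintro f ⟨hf0, hf1⟩
    exact ⟨f.toEquiv.symm_apply_eq.2 hf0.symm, f.toEquiv.symm_apply_eq.2 hf1.symm⟩

/-- A homeomorphism in `Homeo₊[0,1]` as a continuous map. -/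
def HomeoPlus.toContinuousMap (f : HomeoPlus) : C(unitInterval, unitInterval) :=
  ⟨f.1, f.1.continuous⟩

/-- The compact-open topology on `Homeo₊[0,1]`. -/
instance HomeoPlus.compactOpenTopology : TopologicalSpace HomeoPlus :=
  TopologicalSpace.induced HomeoPlus.toContinuousMap inferInstance

instance HomeoPlus.isTopologicalGroup : IsTopologicalGroup HomeoPlus where
  continuous_mul := by
    have hc : Continuous HomeoPlus.toContinuousMap := continuous_induced_dom
    refine continuous_induced_rng.2 ?_
    exact (hc.comp continuous_fst).compCM (hc.comp continuous_snd)
  continuous_inv := by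
    have hc : Continuous HomeoPlus.toContinuousMap := continuous_induced_dom
    refine continuous_induced_rng.2 (continuous_iff_continuousAt.2 fun f => ?_)
    have h1 : Tendsto (fun g : HomeoPlus => (HomeoPlus.toContinuousMap f⁻¹).comp (HomeoPlus.toContinuousMap g)) (𝓝 f)
        (𝓝 ((HomeoPlus.toContinuousMap f⁻¹).comp (HomeoPlus.toContinuousMap f))) :=
      ((continuous_const (y := (HomeoPlus.toContinuousMap f⁻¹))).compCM hc).tendsto f
    have h2 : (HomeoPlus.toContinuousMap f⁻¹).comp (HomeoPlus.toContinuousMap f) = ContinuousMap.id _ := by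
      ext x
      exact congrArg Subtype.val (f.1.symm_apply_apply x)
    rw [h2, tendsto_iff_dist_tendsto_zero] at h1
    refine tendsto_iff_dist_tendsto_zero.2 (squeeze_zero (fun _ => dist_nonneg) (fun g => ?_) h1)
    refine (ContinuousMap.dist_le dist_nonneg).2 fun y => ?_
    have h3 := ContinuousMap.dist_apply_le_dist
      (f := (HomeoPlus.toContinuousMap f⁻¹).comp (HomeoPlus.toContinuousMap g)) (g := ContinuousMap.id _) (g.1.symm y)
    have h4 : ((HomeoPlus.toContinuousMap f⁻¹).comp (HomeoPlus.toContinuousMap g)) (g.1.symm y)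
        = (HomeoPlus.toContinuousMap f⁻¹) y := congrArg f.1.symm (g.1.apply_symm_apply y)
    rw [h4, dist_comm] at h3
    exact h3

/-! ### The Urysohn space -/

/-- `U` is a Urysohn space: a complete separable metric space which is universal (every separable
metric space embeds into it isometrically) and ultrahomogeneous (every isometry between finite
subspaces extends to an isometry of `U` onto itself). It is unique up to isometry. -/
structure IsUrysohnSpace (U : Type) [MetricSpace U] : Prop where
  complete : CompleteSpace U
  separable : TopologicalSpace.SeparableSpace U
  universal : ∀ (Y : Type) [MetricSpace Y] [TopologicalSpace.SeparableSpace Y],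
    ∃ f : Y → U, Isometry f
  ultrahomogeneous : ∀ (A : Finset U) (f : A → U), Isometry f →
    ∃ g : U ≃ᵢ U, ∀ a : A, g a = f a

/-! ### Stabilizers in the left completion -/

/-! For a continuous isometric action, d(gx, hx) = d(x, g⁻¹hx), so each orbit map g ↦ gx is
uniformly continuous for the left uniformity and extends to an equivariant map F from the left
completion to the complete space X. The stabilizer of z therefore fixes F(z). If that stabilizer
lies in no compact subset of G, the action is neither proper nor free (`exists_stabilizer_subset`,
`HasUnboundedStabilizer.noProperOrFreeIsometricAction`). It remains to produce such a z as the limit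
of a left Cauchy sequence g_n; an element s fixes z as soon as g_n⁻¹ s g_n → 1
(`hasUnboundedStabilizer_of_seq`).

In S_∞ let g_n tend to the injection i ↦ 2i+1: transpositions of even numbers fix the limit. This
passes to any G receiving a continuous homomorphism from S_∞ that moves some point along a separated
sequence (`hasUnboundedStabilizer_of_perm`). For U(ℓ²) this is the permutation of coordinates. For a
Urysohn sphere, S_∞ must act on 𝕌 fixing the centre and permuting equidistant points of the sphere:
start from an equilateral space, iterate Katětov extensions, complete, and use uniqueness of pointed
Urysohn spaces (`exists_isUrysohnSpace_rep`, `IsUrysohnSpace.exists_isometryEquiv`). In Homeo₊[0,1],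
g_n is the inverse of a homeomorphism close to max(0, 2x−1), and homeomorphisms supported in the
collapsed interval [0,1/2] fix the limit.

Each group is Polish because recording an element together with its inverse, or being a closed
subgroup of an isometry group, gives a closed embedding into a Polish space. -/

/-- Some element of the left completion of `G` has a stabilizer which is not relatively compact. -/
def HasUnboundedStabilizer (G : Type u) [Group G] [TopologicalSpace G]
    [IsTopologicalGroup G] : Prop :=
  ∃ z : LeftCompletion G, ∀ K : Set G, IsCompact K → ¬ {g : G | leftMulCompletion g z = z} ⊆ K

section Stabilizer

variable {G : Type u} [Group G] [TopologicalSpace G] [IsTopologicalGroup G]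

theorem HasUnboundedStabilizer.hasNoncompactStabilizer (h : HasUnboundedStabilizer G) :
    HasNoncompactStabilizer G := by
  obtain ⟨z, hz⟩ := h
  exact ⟨z, fun hc => hz _ hc subset_rfl⟩

/-- The orbit map of a continuous isometric action extends equivariantly to the left completion, so
the stabilizer of any point of the left completion fixes a point. -/
theorem exists_stabilizer_subset (z : LeftCompletion G) {X : Type v} [MetricSpace X]
    [CompleteSpace X] [Nonempty X] (π : G →* (X ≃ᵢ X))
    (hπ : Continuous (fun p : G × X => π p.1 p.2)) :
    ∃ y : X, {g : G | leftMulCompletion g z = z} ⊆ {g | π g y = y} := by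
  let _ : UniformSpace G := IsTopologicalGroup.leftUniformSpace G
  obtain ⟨x⟩ := ‹Nonempty X›
  have hu : UniformContinuous (fun g : G => π g x) := by
    have e : uniformity G = comap (fun p : G × G => p.1⁻¹ * p.2) (𝓝 1) := rfl
    rw [UniformContinuous, Metric.uniformity_eq_comap_nhds_zero, tendsto_comap_iff, e]
    have h1 : Tendsto (fun g : G => dist x (π g x)) (𝓝 1) (𝓝 0) := by
      have : Continuous fun g : G => dist x (π g x) :=
        continuous_const.dist (hπ.comp (Continuous.prodMk_left x))
      simpa using this.tendsto 1
    -- Applying the isometry `π p.1` turns d(x, p.1⁻¹p.2 x) into d(p.1 x, p.2 x).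
    refine (h1.comp tendsto_comap).congr fun p => ?_
    have : π (p.1⁻¹ * p.2) x = (π p.1)⁻¹ (π p.2 x) := by rw [map_mul, map_inv]; rfl
    simp only [Function.comp_apply, this]
    rw [← (π p.1).dist_eq]
    congr 1
    exact (π p.1).apply_symm_apply _
  let F : LeftCompletion G → X := UniformSpace.Completion.extension fun g : G => π g x
  have hF : Continuous F := UniformSpace.Completion.continuous_extension
  have key : ∀ (g : G) (w : LeftCompletion G), F (leftMulCompletion g w) = π g (F w) := by
    intro g w
    have hg := uniformContinuous_leftTranslation G g
    refine UniformSpace.Completion.induction_on w (isClosed_eq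
      (hF.comp UniformSpace.Completion.continuous_map) ((π g).continuous.comp hF)) fun h => ?_
    have h1 : leftMulCompletion g (h : UniformSpace.Completion G)
        = ((g * h : G) : UniformSpace.Completion G) := UniformSpace.Completion.map_coe hg h
    rw [h1]
    have h2 : ∀ k : G, F (k : UniformSpace.Completion G) = π k x :=
      fun k => UniformSpace.Completion.extension_coe hu k
    rw [h2, h2, map_mul]
    rfl
  refine ⟨F z, fun g hg => ?_⟩
  have hg' : leftMulCompletion g z = z := hg
  change π g (F z) = F z
  rw [← key, hg']

/-- The stabilizer of y in X is the projection of the preimage of {(y, y)}, hence compact if the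
action is proper; if the action is free it is {1}. Either way a compact set would contain the
stabilizer of z. -/
theorem HasUnboundedStabilizer.noProperOrFreeIsometricAction (h : HasUnboundedStabilizer G) :
    NoProperOrFreeIsometricAction.{u, v} G := by
  obtain ⟨z, hz⟩ := h
  intro X _ _ _ π hπ
  obtain ⟨y, hy⟩ := exists_stabilizer_subset z π hπ
  constructor
  · intro hp
    refine hz _ ((hp {(y, y)} isCompact_singleton).image continuous_fst) fun g hg => ?_
    exact ⟨(g, y), by simpa using hy hg, rfl⟩
  · intro hf
    exact hz {1} isCompact_singleton fun g hg => hf g y (hy hg)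

/-- A left Cauchy sequence `g` converges to a point of the left completion fixed by every element
which is conjugated to the identity in the limit along `g`. -/
theorem hasUnboundedStabilizer_of_seq {ι : Type*} (g : ℕ → G) (s : ι → G)
    (hg : Tendsto (fun p : ℕ × ℕ => (g p.1)⁻¹ * g p.2) atTop (𝓝 1))
    (hs : ∀ k, Tendsto (fun n => (g n)⁻¹ * s k * g n) atTop (𝓝 1))
    (hK : ∀ K : Set G, IsCompact K → ¬ Set.range s ⊆ K) : HasUnboundedStabilizer G := by
  let _ : UniformSpace G := IsTopologicalGroup.leftUniformSpace G
  have e : uniformity G = comap (fun p : G × G => p.1⁻¹ * p.2) (𝓝 1) := rfl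
  have hc : CauchySeq g := by
    rw [cauchySeq_iff_tendsto, e, tendsto_comap_iff]
    exact hg
  have hc' : CauchySeq fun n => (g n : UniformSpace.Completion G) :=
    hc.map (UniformSpace.Completion.uniformContinuous_coe G)
  obtain ⟨z, hz⟩ := cauchySeq_tendsto_of_complete hc'
  refine ⟨z, fun K hKc hsub => hK K hKc ?_⟩
  rintro _ ⟨k, rfl⟩
  refine hsub ?_
  -- The left difference of these two elements is the conjugate g_n⁻¹ s_k g_n, so both sequences
  -- have the same limit in the completion: z, which is also s_k z.
  have h1 : Tendsto (fun n => (g n, s k * g n)) atTop (uniformity G) := by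
    rw [e, tendsto_comap_iff]
    refine (hs k).congr fun n => ?_
    simp [mul_assoc]
  have h2 := Tendsto.congr_uniformity hz
    (Tendsto.comp (UniformSpace.Completion.uniformContinuous_coe G) h1)
  have hsk := uniformContinuous_leftTranslation G (s k)
  have h3 : Tendsto (fun n => leftMulCompletion (s k) (g n : UniformSpace.Completion G)) atTop
      (𝓝 (leftMulCompletion (s k) z)) :=
    (UniformSpace.Completion.continuous_map.tendsto z).comp hz
  refine tendsto_nhds_unique h3 (h2.congr fun n => ?_)
  exact (UniformSpace.Completion.map_coe hsk (g n)).symm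

end Stabilizer

theorem NoProperOrFreeIsometricAction.affine {G : Type u} [Group G] [TopologicalSpace G]
    (h : NoProperOrFreeIsometricAction.{u, v} G) :
    NoProperOrFreeAffineIsometricAction.{u, v} G := by
  intro E _ _ _ π hπ
  let ψ : (E ≃ᵃⁱ[ℝ] E) →* (E ≃ᵢ E) :=
    { toFun := fun g => g.toIsometryEquiv
      map_one' := rfl
      map_mul' := fun _ _ => rfl }
  exact h E (ψ.comp π) hπ

/-! ### The infinite symmetric group -/

namespace SInfty

/-- A pointwise limit of permutations may fail to be surjective; for pairs of functions, being
mutually inverse is a closed condition. -/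
theorem isClosedEmbedding_prodInv :
    IsClosedEmbedding fun σ : Equiv.Perm ℕ => ((σ : ℕ → ℕ), ((σ⁻¹ : Equiv.Perm ℕ) : ℕ → ℕ)) := by
  have hi : IsInducing (fun σ : Equiv.Perm ℕ => (σ : ℕ → ℕ)) := ⟨rfl⟩
  have hc : Continuous fun σ : Equiv.Perm ℕ => ((σ : ℕ → ℕ), ((σ⁻¹ : Equiv.Perm ℕ) : ℕ → ℕ)) :=
    hi.continuous.prodMk (hi.continuous.comp continuous_inv)
  refine ⟨⟨.of_comp hc continuous_fst hi, fun σ τ h => ?_⟩, ?_⟩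
  · exact DFunLike.coe_injective (congrArg Prod.fst h)
  · have : Set.range (fun σ : Equiv.Perm ℕ => ((σ : ℕ → ℕ), ((σ⁻¹ : Equiv.Perm ℕ) : ℕ → ℕ))) =
        ⋂ n, ({p : (ℕ → ℕ) × (ℕ → ℕ) | p.1 (p.2 n) = n} ∩ {p | p.2 (p.1 n) = n}) := by
      ext p
      simp only [Set.mem_range, Set.mem_iInter, Set.mem_inter_iff, Set.mem_ofPred_eq]
      constructor
      · rintro ⟨σ, rfl⟩ n
        simp
      · intro h
        exact ⟨⟨p.1, p.2, fun n => (h n).2, fun n => (h n).1⟩, rfl⟩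
    rw [this]
    have hev : Continuous fun q : (ℕ → ℕ) × ℕ => q.1 q.2 := by
      rw [continuous_prod_of_discrete_right]
      exact fun n => continuous_apply n
    refine isClosed_iInter fun n => IsClosed.inter ?_ ?_
    · exact isClosed_eq (hev.comp (continuous_fst.prodMk ((continuous_apply n).comp continuous_snd)))
        continuous_const
    · exact isClosed_eq (hev.comp (continuous_snd.prodMk ((continuous_apply n).comp continuous_fst)))
        continuous_const

theorem polishSpace : PolishSpace (Equiv.Perm ℕ) :=
  isClosedEmbedding_prodInv.polishSpace

/-- A sequence of permutations converging pointwise to `i ↦ 2 * i + 1`. -/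
def toOdd : ℕ → Equiv.Perm ℕ
  | 0 => 1
  -- The swap corrects the value at n to 2n+1. Earlier values 2i+1 differ from both swapped points,
  -- so they stay.
  | n + 1 => Equiv.swap (toOdd n n) (2 * n + 1) * toOdd n

theorem toOdd_apply {i n : ℕ} (h : i < n) : toOdd n i = 2 * i + 1 := by
  induction n with
  | zero => omega
  | succ n ih =>
    rcases Nat.lt_succ_iff_lt_or_eq.1 h with h | rfl
    · have h1 : toOdd n i ≠ toOdd n n := fun he => h.ne ((toOdd n).injective he)
      rw [toOdd, Equiv.Perm.mul_apply, Equiv.swap_apply_of_ne_of_ne h1, ih h]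
      rw [ih h]; omega
    · simp [toOdd]

theorem tendsto_toOdd_inv_mul :
    Tendsto (fun p : ℕ × ℕ => (toOdd p.1)⁻¹ * toOdd p.2) atTop (𝓝 1) := by
  refine tendsto_pointwise.2 fun i => ?_
  filter_upwards [eventually_ge_atTop (i + 1, i + 1)] with p hp
  rw [Equiv.Perm.mul_apply, toOdd_apply (Nat.lt_of_succ_le hp.2), Equiv.Perm.inv_eq_iff_eq]
  simp [toOdd_apply (Nat.lt_of_succ_le hp.1)]

/-- For i < n, `toOdd n` sends i to an odd number, which a transposition of two even numbers leaves
alone. -/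
theorem tendsto_conj_swap (k : ℕ) :
    Tendsto (fun n => (toOdd n)⁻¹ * Equiv.swap 0 (2 * k) * toOdd n) atTop (𝓝 1) := by
  refine tendsto_pointwise.2 fun i => ?_
  filter_upwards [eventually_ge_atTop (i + 1)] with n hn
  rw [Equiv.Perm.mul_apply, Equiv.Perm.mul_apply, toOdd_apply (Nat.lt_of_succ_le hn),
    Equiv.Perm.inv_eq_iff_eq, Equiv.swap_apply_of_ne_of_ne (by omega) (by omega)]
  simp [toOdd_apply (Nat.lt_of_succ_le hn)]

end SInfty

/-- A group acted on by `S_∞` through a continuous homomorphism moving a separated sequence has an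
unbounded stabilizer. -/
theorem hasUnboundedStabilizer_of_perm {G : Type u} [Group G] [TopologicalSpace G]
    [IsTopologicalGroup G] {Y : Type v} [PseudoMetricSpace Y] (φ : Equiv.Perm ℕ →* G)
    (hφ : Continuous φ) (ev : G → Y) (hev : Continuous ev) (e : ℕ → Y)
    (he : ∀ σ, ev (φ σ) = e (σ 0)) {r : ℝ} (hr : 0 < r)
    (hsep : Pairwise fun m n => r ≤ dist (e m) (e n)) : HasUnboundedStabilizer G := by
  have h1 : Tendsto φ (𝓝 1) (𝓝 1) := by simpa using hφ.tendsto 1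
  refine hasUnboundedStabilizer_of_seq (fun n => φ (SInfty.toOdd n))
    (fun k => φ (Equiv.swap 0 (2 * k))) ?_ (fun k => ?_) fun K hK hsub => ?_
  · simpa [Function.comp_def] using h1.comp SInfty.tendsto_toOdd_inv_mul
  · simpa [Function.comp_def] using h1.comp (SInfty.tendsto_conj_swap k)
  -- The swap of 0 and 2k is evaluated to e(2k). A compact set containing all the swaps would give
  -- this separated sequence a convergent subsequence.
  · have hc : IsSeqCompact (ev '' K) := (hK.image hev).isSeqCompact
    obtain ⟨y, -, ψ, hψ, hy⟩ := hc (x := fun k => e (2 * k)) fun k =>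
      ⟨_, hsub ⟨k, rfl⟩, by rw [he, Equiv.swap_apply_left]⟩
    obtain ⟨N, hN⟩ := Metric.cauchySeq_iff'.1 hy.cauchySeq r hr
    refine absurd (hN (N + 1) (by omega)) (not_lt.2 (hsep ?_))
    have := hψ (Nat.lt_add_one N)
    omega

theorem SInfty.hasUnboundedStabilizer : HasUnboundedStabilizer (Equiv.Perm ℕ) := by
  have hev : Continuous fun σ : Equiv.Perm ℕ => σ 0 :=
    (continuous_apply 0).comp continuous_induced_dom
  refine hasUnboundedStabilizer_of_perm (MonoidHom.id _) continuous_id (fun σ => σ 0) hev id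
    (fun _ => rfl) one_pos fun m n h => ?_
  change 1 ≤ |(m : ℝ) - n|
  have : (m : ℤ) - n ≠ 0 := sub_ne_zero.2 (by exact_mod_cast h)
  exact_mod_cast Int.one_le_abs this

/-! ### Distance-preserving relations -/

/-- A relation between metric spaces which preserves distances. -/
def DistPreserving {X : Type u} {Y : Type v} [MetricSpace X] [MetricSpace Y]
    (R : Set (X × Y)) : Prop :=
  ∀ p ∈ R, ∀ q ∈ R, dist p.1 q.1 = dist p.2 q.2

namespace DistPreserving

variable {X : Type u} {Y : Type v} [MetricSpace X] [MetricSpace Y] {R : Set (X × Y)}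

theorem closure (h : DistPreserving R) : DistPreserving (closure R) := by
  intro p hp q hq
  have hm : (p, q) ∈ _root_.closure (R ×ˢ R) := by
    rw [closure_prod_eq]
    exact ⟨hp, hq⟩
  have hc : IsClosed {w : (X × Y) × (X × Y) | dist w.1.1 w.2.1 = dist w.1.2 w.2.2} :=
    isClosed_eq (by fun_prop) (by fun_prop)
  exact closure_minimal (fun w hw => h _ hw.1 _ hw.2) hc hm

theorem swap (h : DistPreserving R) : DistPreserving (Prod.swap '' R) := by
  rintro _ ⟨p, hp, rfl⟩ _ ⟨q, hq, rfl⟩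
  exact (h p hp q hq).symm

theorem exists_mem_closure [CompleteSpace Y] (h : DistPreserving R) (hd : Dense (Prod.fst '' R))
    (x : X) : ∃ y, (x, y) ∈ _root_.closure R := by
  obtain ⟨a, ha, hx⟩ := mem_closure_iff_seq_limit.1 (hd x)
  choose p hp hpa using ha
  have hx' : Tendsto (fun n => (p n).1) atTop (𝓝 x) := by simpa only [hpa] using hx
  have hc : CauchySeq fun n => (p n).2 := by
    refine Metric.cauchySeq_iff.2 fun ε hε => ?_
    obtain ⟨N, hN⟩ := Metric.cauchySeq_iff.1 hx'.cauchySeq ε hε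
    exact ⟨N, fun m hm n hn => by rw [← h _ (hp m) _ (hp n)]; exact hN m hm n hn⟩
  obtain ⟨y, hy⟩ := cauchySeq_tendsto_of_complete hc
  exact ⟨y, mem_closure_of_tendsto (hx'.prodMk_nhds hy) (Eventually.of_forall hp)⟩

theorem exists_isometry [CompleteSpace Y] (h : DistPreserving R) (hd : Dense (Prod.fst '' R)) :
    ∃ f : X → Y, Isometry f ∧ (∀ p ∈ R, f p.1 = p.2) ∧ ∀ x, (x, f x) ∈ _root_.closure R := by
  choose f hf using h.exists_mem_closure hd
  refine ⟨f, Isometry.of_dist_eq fun x y => (h.closure _ (hf x) _ (hf y)).symm, fun p hp => ?_, hf⟩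
  have := h.closure _ (hf p.1) _ (subset_closure hp)
  rw [dist_self] at this
  exact dist_eq_zero.1 this.symm

/-- The isometries obtained from R and from its transpose both have their graphs in the closure of R
(up to transposition). That closure preserves distances, so two of its points with the same first
coordinate agree: the maps are mutually inverse. -/
theorem exists_isometryEquiv [CompleteSpace X] [CompleteSpace Y] (h : DistPreserving R)
    (hd : Dense (Prod.fst '' R)) (hd' : Dense (Prod.snd '' R)) :
    ∃ f : X ≃ᵢ Y, ∀ p ∈ R, f p.1 = p.2 := by
  obtain ⟨f, hf, hfR, hfc⟩ := h.exists_isometry hd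
  obtain ⟨g, -, -, hgc⟩ := h.swap.exists_isometry (by rwa [← Set.image_comp])
  refine ⟨IsometryEquiv.mk' f g (fun y => ?_) hf, hfR⟩
  have h1 : (g y, y) ∈ _root_.closure R := by
    have := mem_closure_image (f := Prod.swap) continuous_swap.continuousAt (hgc y)
    rw [← Set.image_comp] at this
    simpa using this
  have h2 := h.closure _ h1 _ (hfc (g y))
  rw [dist_self] at h2
  exact (dist_eq_zero.1 h2.symm).symm

end DistPreserving

/-! ### Isometry groups -/

namespace IsometryEquiv

variable {X : Type u} [MetricSpace X]

/-- Isometries are equicontinuous, so an ε/3 argument applies. Convergence can thus be tested on a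
dense set. -/
theorem isClosed_tendsto_apply {ι : Type v} {l : Filter ι} (f : ι → (X ≃ᵢ X)) (g : X ≃ᵢ X) :
    IsClosed {x | Tendsto (fun i => f i x) l (𝓝 (g x))} := by
  refine isClosed_of_closure_subset fun x hx => Metric.tendsto_nhds.2 fun ε hε => ?_
  obtain ⟨y, hy, hxy⟩ := Metric.mem_closure_iff.1 hx (ε / 3) (by positivity)
  filter_upwards [Metric.tendsto_nhds.1 hy (ε / 3) (by positivity)] with i hi
  have h1 := dist_triangle4 (f i x) (f i y) (g y) (g x)
  rw [(f i).dist_eq, g.dist_eq, dist_comm y x] at h1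
  linarith

theorem tendsto_of_dense {ι : Type v} {l : Filter ι} {f : ι → (X ≃ᵢ X)} {g : X ≃ᵢ X} {s : Set X}
    (hs : Dense s) (h : ∀ x ∈ s, Tendsto (fun i => f i x) l (𝓝 (g x))) : Tendsto f l (𝓝 g) :=
  tendsto_pointwise.2 fun x => closure_minimal h (isClosed_tendsto_apply f g) (hs x)

theorem continuous_apply (x : X) : Continuous fun g : X ≃ᵢ X => g x :=
  (_root_.continuous_apply x).comp continuous_induced_dom

/-- An isometry is encoded by the images of a dense sequence under it and under its inverse. The
image of this encoding is cut out by distance equations, hence closed; the mixed equation d(g d_i,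
d_j) = d(d_i, g⁻¹ d_j) ties the two halves together. -/
theorem polishSpace [CompleteSpace X] [TopologicalSpace.SeparableSpace X] :
    PolishSpace (X ≃ᵢ X) := by
  rcases isEmpty_or_nonempty X with hX | hX
  · have : Subsingleton (X ≃ᵢ X) := ⟨fun f g => IsometryEquiv.ext fun x => hX.elim x⟩
    have : DiscreteTopology (X ≃ᵢ X) := Subsingleton.discreteTopology
    have : Countable (X ≃ᵢ X) := Finite.to_countable
    infer_instance
  let d := TopologicalSpace.denseSeq X
  have hd : DenseRange d := TopologicalSpace.denseRange_denseSeq X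
  let F : (X ≃ᵢ X) → (ℕ → X) × (ℕ → X) := fun g => (fun n => g (d n), fun n => g⁻¹ (d n))
  have hF : Continuous F := by
    refine Continuous.prodMk (continuous_pi fun n => continuous_apply _)
      (continuous_pi fun n => (continuous_apply _).comp continuous_inv)
  have hind : IsInducing F := by
    refine isInducing_iff_nhds.2 fun g => le_antisymm hF.continuousAt.le_comap ?_
    change Tendsto id (comap F (𝓝 (F g))) (𝓝 g)
    refine tendsto_of_dense (s := Set.range d) hd ?_
    rintro _ ⟨n, rfl⟩
    have h1 : Tendsto (fun p : (ℕ → X) × (ℕ → X) => p.1 n) (𝓝 (F g)) (𝓝 (g (d n))) :=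
      Continuous.tendsto (by fun_prop) (F g)
    exact h1.comp tendsto_comap
  have hinj : Function.Injective F := fun g h hgh => by
    refine IsometryEquiv.ext fun x => ?_
    refine congrFun (hd.equalizer g.continuous h.continuous ?_) x
    exact congrArg Prod.fst hgh
  have hrange : Set.range F = {p : (ℕ → X) × (ℕ → X) |
      (∀ i j, dist (p.1 i) (p.1 j) = dist (d i) (d j)) ∧
      (∀ i j, dist (p.2 i) (p.2 j) = dist (d i) (d j)) ∧
      ∀ i j, dist (p.1 i) (d j) = dist (d i) (p.2 j)} := by
    ext p
    constructor
    · rintro ⟨g, rfl⟩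
      refine ⟨fun i j => g.dist_eq _ _, fun i j => g⁻¹.dist_eq _ _, fun i j => ?_⟩
      have := g.dist_eq (d i) (g⁻¹ (d j))
      rwa [apply_inv_self] at this
    · rintro ⟨h1, h2, h3⟩
      -- The first family makes the domain dense, the second the range; the latter yields
      -- surjectivity.
      let R : Set (X × X) := Set.range (fun i => (d i, p.1 i)) ∪ Set.range (fun i => (p.2 i, d i))
      have hR : DistPreserving R := by
        rintro _ (⟨i, rfl⟩ | ⟨i, rfl⟩) _ (⟨j, rfl⟩ | ⟨j, rfl⟩)
        · exact (h1 i j).symm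
        · exact (h3 i j).symm
        · simpa only [dist_comm] using (h3 j i).symm
        · exact h2 i j
      obtain ⟨f, hf⟩ := hR.exists_isometryEquiv
        (hd.mono (by rintro _ ⟨n, rfl⟩; exact ⟨_, Or.inl ⟨n, rfl⟩, rfl⟩))
        (hd.mono (by rintro _ ⟨n, rfl⟩; exact ⟨_, Or.inr ⟨n, rfl⟩, rfl⟩))
      refine ⟨f, Prod.ext (funext fun n => hf _ (Or.inl ⟨n, rfl⟩)) (funext fun n => ?_)⟩
      exact f.symm_apply_eq.2 (hf _ (Or.inr ⟨n, rfl⟩)).symm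
  have hcl : IsClosedEmbedding F := by
    refine ⟨⟨hind, hinj⟩, ?_⟩
    rw [hrange]
    simp only [Set.ofPred_and, Set.ofPred_forall]
    refine IsClosed.inter ?_ (IsClosed.inter ?_ ?_) <;>
      exact isClosed_iInter fun i => isClosed_iInter fun j =>
        isClosed_eq (by fun_prop) (by fun_prop)
  exact hcl.polishSpace

end IsometryEquiv

/-! ### Homeomorphisms of the interval -/

namespace HomeoPlus

theorem continuous_toContinuousMap : Continuous toContinuousMap := continuous_induced_dom

theorem ext {f g : HomeoPlus} (h : ∀ x, f.1 x = g.1 x) : f = g :=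
  Subtype.ext (Homeomorph.ext h)

theorem polishSpace : PolishSpace HomeoPlus := by
  let F : HomeoPlus → C(unitInterval, unitInterval) × C(unitInterval, unitInterval) :=
    fun f => (toContinuousMap f, toContinuousMap f⁻¹)
  have hi : IsInducing toContinuousMap := ⟨rfl⟩
  have hF : Continuous F := hi.continuous.prodMk (hi.continuous.comp continuous_inv)
  have hcl : IsClosedEmbedding F := by
    refine ⟨⟨.of_comp hF continuous_fst hi, fun f g h => ?_⟩, ?_⟩
    · exact ext fun x => DFunLike.congr_fun (congrArg Prod.fst h) x
    · have : Set.range F = {p | p.1.comp p.2 = ContinuousMap.id _ ∧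
          p.2.comp p.1 = ContinuousMap.id _ ∧ p.1 0 = 0 ∧ p.1 1 = 1} := by
        ext p
        constructor
        · rintro ⟨f, rfl⟩
          exact ⟨ContinuousMap.ext fun x => f.1.apply_symm_apply x,
            ContinuousMap.ext fun x => f.1.symm_apply_apply x, f.2.1, f.2.2⟩
        · rintro ⟨h1, h2, h3, h4⟩
          let f : unitInterval ≃ₜ unitInterval :=
            { toFun := p.1
              invFun := p.2
              left_inv := fun x => DFunLike.congr_fun h2 x
              right_inv := fun x => DFunLike.congr_fun h1 x
              continuous_toFun := p.1.continuous
              continuous_invFun := p.2.continuous }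
          exact ⟨⟨f, h3, h4⟩, rfl⟩
      rw [this]
      refine IsClosed.inter ?_ (IsClosed.inter ?_ (IsClosed.inter ?_ ?_))
      · exact isClosed_eq (continuous_fst.compCM continuous_snd) continuous_const
      · exact isClosed_eq (continuous_snd.compCM continuous_fst) continuous_const
      · exact isClosed_eq (by fun_prop) continuous_const
      · exact isClosed_eq (by fun_prop) continuous_const
  exact hcl.polishSpace

/-- A strictly increasing continuous function fixing the endpoints restricts to a homeomorphism of
`[0,1]`. -/
theorem exists_of_strictMono (f : ℝ → ℝ) (hf : Continuous f) (hm : StrictMono f) (h0 : f 0 = 0)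
    (h1 : f 1 = 1) : ∃ g : HomeoPlus, ∀ x, (g.1 x : ℝ) = f x := by
  have hmem : ∀ x : unitInterval, f x ∈ unitInterval := fun x =>
    ⟨h0 ▸ hm.monotone x.2.1, h1 ▸ hm.monotone x.2.2⟩
  let F : unitInterval → unitInterval := fun x => ⟨f x, hmem x⟩
  have hF : StrictMono F := fun x y hxy => hm hxy
  have hs : Function.Surjective F := fun y => by
    obtain ⟨x, hx, hxy⟩ := intermediate_value_Icc zero_le_one hf.continuousOn
      (show (y : ℝ) ∈ Set.Icc (f 0) (f 1) by rw [h0, h1]; exact y.2)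
    exact ⟨⟨x, hx⟩, Subtype.ext hxy⟩
  refine ⟨⟨(hF.orderIsoOfSurjective F hs).toHomeomorph, ?_, ?_⟩, fun x => rfl⟩
  · exact Subtype.ext h0
  · exact Subtype.ext h1

theorem tendsto_one {ι : Type v} {l : Filter ι} {f : ι → HomeoPlus} {δ : ι → ℝ}
    (hδ : Tendsto δ l (𝓝 0)) (h : ∀ i x, dist ((f i).1 x) x ≤ δ i) : Tendsto f l (𝓝 1) := by
  rw [nhds_induced, tendsto_comap_iff, tendsto_iff_dist_tendsto_zero]
  refine squeeze_zero (fun _ => dist_nonneg) (fun i => ?_) hδ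
  exact (ContinuousMap.dist_le (dist_nonneg.trans (h i 0))).2 fun x => h i x

/-- The witnesses max(x/(n+1), 2x−1) are strictly increasing and approach a map that collapses
[0,1/2], so their limit is not a homeomorphism. -/
theorem exists_flattening : ∃ f : ℕ → HomeoPlus,
    ∀ (n : ℕ) (x : unitInterval), |((f n).1 x : ℝ) - max 0 (2 * (x : ℝ) - 1)| ≤ 1 / (n + 1) := by
  have key : ∀ n : ℕ, ∃ g : HomeoPlus, ∀ x,
      (g.1 x : ℝ) = max ((x : ℝ) / (n + 1)) (2 * (x : ℝ) - 1) := by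
    intro n
    have hn : (0 : ℝ) < n + 1 := by positivity
    refine exists_of_strictMono (fun x => max (x / (n + 1)) (2 * x - 1)) (by fun_prop)
      (fun x y hxy => max_lt_max (div_lt_div_of_pos_right hxy hn) (by linarith)) (by norm_num) ?_
    rw [max_eq_right]
    · norm_num
    · rw [div_le_iff₀ hn]
      nlinarith
  choose f hf using key
  refine ⟨f, fun n x => ?_⟩
  rw [hf]
  have hn : (0 : ℝ) < n + 1 := by positivity
  have h1 : (x : ℝ) / (n + 1) ≤ 1 / (n + 1) := div_le_div_of_nonneg_right x.2.2 hn.le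
  have h2 : 0 ≤ (x : ℝ) / (n + 1) := div_nonneg x.2.1 hn.le
  refine (abs_max_sub_max_le_max _ _ _ _).trans (max_le ?_ ?_)
  · rwa [sub_zero, abs_of_nonneg h2]
  · rw [sub_self, abs_zero]; positivity

/-- These maps rise steeply from 0 and then run just below 1/2. Their limit is constant on (0,1/2],
which excludes a cluster point in the group. -/
theorem exists_pushing : ∃ s : ℕ → HomeoPlus,
    (∀ n (x : unitInterval), 1 / 2 ≤ (x : ℝ) → (s n).1 x = x) ∧
    (∀ n (x : unitInterval), (x : ℝ) ≤ 1 / 2 → ((s n).1 x : ℝ) ≤ 1 / 2) ∧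
    ∀ x : unitInterval, 0 < (x : ℝ) → (x : ℝ) ≤ 1 / 2 →
      Tendsto (fun n => ((s n).1 x : ℝ)) atTop (𝓝 (1 / 2)) := by
  have key : ∀ n : ℕ, ∃ g : HomeoPlus, ∀ x, (g.1 x : ℝ) =
      max (x : ℝ) (min ((n + 1) * (x : ℝ)) (1 / 2 + ((x : ℝ) - 1 / 2) / (n + 1))) := by
    intro n
    have hn : (0 : ℝ) < n + 1 := by positivity
    refine exists_of_strictMono
      (fun x => max x (min ((n + 1) * x) (1 / 2 + (x - 1 / 2) / (n + 1)))) (by fun_prop)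
      (fun x y hxy => max_lt_max hxy (min_lt_min (mul_lt_mul_of_pos_left hxy hn) ?_)) ?_ ?_
    · have := div_lt_div_of_pos_right (sub_lt_sub_right hxy (1 / 2)) hn
      linarith
    · rw [mul_zero]
      exact max_eq_left (min_le_left _ _)
    · refine max_eq_left ((min_le_right _ _).trans ?_)
      have : (1 - 1 / 2 : ℝ) / (n + 1) ≤ (1 - 1 / 2) / 1 :=
        div_le_div_of_nonneg_left (by norm_num) one_pos (by linarith [Nat.cast_nonneg (α := ℝ) n])
      linarith
  choose s hs using key
  refine ⟨s, fun n x hx => Subtype.ext ?_, fun n x hx => ?_, fun x hx hx' => ?_⟩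
  · rw [hs]
    refine max_eq_left ((min_le_right _ _).trans ?_)
    have : ((x : ℝ) - 1 / 2) / (n + 1) ≤ (x - 1 / 2) / 1 :=
      div_le_div_of_nonneg_left (by linarith) one_pos (by linarith [Nat.cast_nonneg (α := ℝ) n])
    linarith
  · rw [hs]
    refine max_le hx ((min_le_right _ _).trans ?_)
    have : ((x : ℝ) - 1 / 2) / (n + 1) ≤ 0 :=
      div_nonpos_of_nonpos_of_nonneg (by linarith) (by positivity)
    linarith
  · have h1 : Tendsto (fun n : ℕ => (n + 1 : ℝ) * x) atTop atTop :=
      (tendsto_atTop_add_const_right _ _ tendsto_natCast_atTop_atTop).atTop_mul_const hx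
    have h2 : Tendsto (fun n : ℕ => (1 / 2 : ℝ) + ((x : ℝ) - 1 / 2) / (n + 1)) atTop
        (𝓝 (1 / 2)) := by
      have := (tendsto_one_div_add_atTop_nhds_zero_nat (𝕜 := ℝ)).const_mul ((x : ℝ) - 1 / 2)
      simpa [div_eq_mul_inv] using this.const_add (1 / 2 : ℝ)
    have h3 : Tendsto (fun n : ℕ => max (x : ℝ) (1 / 2 + ((x : ℝ) - 1 / 2) / (n + 1))) atTop
        (𝓝 (1 / 2)) := by
      have := (tendsto_const_nhds (x := (x : ℝ))).max h2
      rwa [max_eq_right hx'] at this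
    refine h3.congr' ?_
    filter_upwards [h1.eventually_ge_atTop 1] with n hn
    rw [hs, min_eq_right]
    have : ((x : ℝ) - 1 / 2) / (n + 1) ≤ 0 :=
      div_nonpos_of_nonpos_of_nonneg (by linarith) (by positivity)
    linarith

theorem hasUnboundedStabilizer : HasUnboundedStabilizer HomeoPlus := by
  obtain ⟨f, hf⟩ := exists_flattening
  obtain ⟨s, hs1, hs2, hs3⟩ := exists_pushing
  have h0 : Tendsto (fun n : ℕ => 1 / ((n : ℝ) + 1)) atTop (𝓝 0) :=
    tendsto_one_div_add_atTop_nhds_zero_nat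
  refine hasUnboundedStabilizer_of_seq (fun n => (f n)⁻¹) s ?_ (fun k => ?_) fun K hK hsub => ?_
  · have h1 : Tendsto (fun p : ℕ × ℕ => 1 / ((p.1 : ℝ) + 1) + 1 / ((p.2 : ℝ) + 1)) atTop (𝓝 0) := by
      rw [← prod_atTop_atTop_eq]
      simpa using (h0.comp tendsto_fst).add (h0.comp tendsto_snd)
    refine tendsto_one h1 fun p x => ?_
    -- With x = f_n(y), the displacement of f_m f_n⁻¹ at x becomes |f_m(y) − f_n(y)|, and both
    -- values are near max(0, 2y−1).
    obtain ⟨y, rfl⟩ := (f p.2).1.surjective x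
    have e : (((f p.1)⁻¹)⁻¹ * (f p.2)⁻¹).1 ((f p.2).1 y) = (f p.1).1 y := by
      rw [inv_inv]
      exact congrArg (f p.1).1 ((f p.2).1.symm_apply_apply y)
    rw [e, Subtype.dist_eq, Real.dist_eq]
    have h2 := hf p.1 y
    have h3 := hf p.2 y
    rw [abs_sub_comm] at h3
    exact (abs_sub_le _ _ _).trans (add_le_add h2 h3)
  · refine tendsto_one (δ := fun n : ℕ => 1 / ((n : ℝ) + 1) + 1 / ((n : ℝ) + 1))
      (by simpa using h0.add h0) fun n x => ?_
    obtain ⟨y, rfl⟩ := (f n).1.surjective x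
    have e : (((f n)⁻¹)⁻¹ * s k * (f n)⁻¹).1 ((f n).1 y) = (f n).1 ((s k).1 y) := by
      rw [inv_inv]
      exact congrArg (fun z => (f n).1 ((s k).1 z)) ((f n).1.symm_apply_apply y)
    rw [e, Subtype.dist_eq, Real.dist_eq]
    have h2 := hf n ((s k).1 y)
    have h3 := hf n y
    rw [abs_sub_comm] at h3
    -- The collapsing map does not see s_k, which only moves points inside [0,1/2].
    have h4 : max 0 (2 * ((s k).1 y : ℝ) - 1) = max 0 (2 * (y : ℝ) - 1) := by
      rcases le_total (y : ℝ) (1 / 2) with hy | hy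
      · rw [max_eq_left, max_eq_left]
        · linarith
        · linarith [hs2 k y hy]
      · rw [hs1 k y hy]
    rw [h4] at h2
    exact (abs_sub_le _ _ _).trans (add_le_add h2 h3)
  · obtain ⟨g, -, hg⟩ := hK.exists_mapClusterPt (u := s) (f := atTop)
      (tendsto_principal.2 (Eventually.of_forall fun n => hsub ⟨n, rfl⟩))
    have hev : ∀ x : unitInterval, 0 < (x : ℝ) → (x : ℝ) ≤ 1 / 2 → (g.1 x : ℝ) = 1 / 2 := by
      intro x hx hx'
      have hc : Continuous fun g : HomeoPlus => (g.1 x : ℝ) :=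
        continuous_subtype_val.comp
          ((continuous_eval_const (F := C(unitInterval, unitInterval)) x).comp
            continuous_toContinuousMap)
      have h1 := hg.tendsto_comp (hc.tendsto g)
      exact eq_of_nhds_neBot (ClusterPt.mono h1 (hs3 x hx hx'))
    -- A cluster point would take the value 1/2 at both 1/4 and 1/2.
    let a : unitInterval := ⟨1 / 4, by norm_num, by norm_num⟩
    let b : unitInterval := ⟨1 / 2, by norm_num, by norm_num⟩
    have hab : g.1 a = g.1 b := Subtype.ext <|
      (hev a (by norm_num [a]) (by norm_num [a])).trans
        (hev b (by norm_num [b]) (by norm_num [b])).symm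
    have := congrArg Subtype.val (g.1.injective hab)
    norm_num [a, b] at this

end HomeoPlus

/-! ### The unitary group -/

namespace UnitaryEllTwo

theorem mem_of_isClosed_of_single (S : Submodule ℂ EllTwo) (hS : IsClosed (S : Set EllTwo))
    (h : ∀ n, lp.single 2 n (1 : ℂ) ∈ S) (f : EllTwo) : f ∈ S := by
  refine hS.mem_of_tendsto (lp.hasSum_single ENNReal.ofNat_ne_top f)
    (Eventually.of_forall fun s => S.sum_mem fun i _ => ?_)
  have : lp.single (E := fun _ : ℕ => ℂ) 2 i (f i) = f i • lp.single 2 i (1 : ℂ) := by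
    rw [← lp.single_smul, smul_eq_mul, mul_one]
  rw [this]
  exact S.smul_mem _ (h i)

instance separableSpace_ellTwo : TopologicalSpace.SeparableSpace EllTwo := by
  have h1 : TopologicalSpace.IsSeparable
      (Submodule.span ℂ (Set.range fun n : ℕ => (lp.single 2 n (1 : ℂ) : EllTwo)) :
        Set EllTwo) :=
    (Set.countable_range _).isSeparable.span
  have h2 : (Submodule.span ℂ (Set.range fun n : ℕ => (lp.single 2 n (1 : ℂ) : EllTwo))
      ).topologicalClosure = ⊤ :=
    Submodule.eq_top_iff'.2 <| mem_of_isClosed_of_single _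
      (Submodule.isClosed_topologicalClosure _) fun n =>
        Submodule.le_topologicalClosure _ (Submodule.subset_span ⟨n, rfl⟩)
  refine TopologicalSpace.isSeparable_univ_iff.1 ?_
  have h3 := h1.closure
  rwa [← Submodule.topologicalClosure_coe, h2] at h3

/-- Forgetting linearity. -/
noncomputable def toIso : UnitaryEllTwo →* (EllTwo ≃ᵢ EllTwo) where
  toFun g := g.toIsometryEquiv
  map_one' := rfl
  map_mul' _ _ := rfl

theorem isInducing_toIso : IsInducing toIso := by
  refine ⟨?_⟩
  unfold UnitaryEllTwo.strongTopology IsometryEquiv.pointwiseTopology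
  rw [induced_compose]
  rfl

/-- Linearity is preserved under pointwise limits, so the unitary group is closed in the Polish
group of all isometries of ℓ². -/
theorem isClosedEmbedding_toIso : IsClosedEmbedding toIso := by
  refine ⟨⟨isInducing_toIso, fun g h hgh => ?_⟩, ?_⟩
  · exact LinearIsometryEquiv.ext fun x => congrArg (fun k : EllTwo ≃ᵢ EllTwo => k x) hgh
  · have : Set.range toIso = {g | (∀ x y, g (x + y) = g x + g y) ∧ ∀ (c : ℂ) x, g (c • x) = c • g x} := by
      ext g
      constructor
      · rintro ⟨g, rfl⟩
        exact ⟨g.map_add, g.map_smul⟩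
      · rintro ⟨h1, h2⟩
        let L : EllTwo ≃ₗ[ℂ] EllTwo :=
          { g.toEquiv with
            map_add' := h1
            map_smul' := h2 }
        refine ⟨⟨L, fun x => ?_⟩, rfl⟩
        have h0 : g 0 = 0 := L.map_zero
        have := g.dist_eq x 0
        rwa [h0, dist_zero_right, dist_zero_right] at this
    rw [this]
    simp only [Set.ofPred_and, Set.ofPred_forall]
    have hc := IsometryEquiv.continuous_apply (X := EllTwo)
    refine IsClosed.inter ?_ ?_
    · exact isClosed_iInter fun x => isClosed_iInter fun y =>
        isClosed_eq (hc _) ((hc _).add (hc _))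
    · exact isClosed_iInter fun c => isClosed_iInter fun y =>
        isClosed_eq (hc _) ((hc _).const_smul c)

theorem polishSpace : PolishSpace UnitaryEllTwo := by
  have := IsometryEquiv.polishSpace (X := EllTwo)
  exact isClosedEmbedding_toIso.polishSpace

/-- Permuting the coordinates. -/
noncomputable def permLinearMap (σ : Equiv.Perm ℕ) : EllTwo →ₗ[ℂ] EllTwo where
  toFun f := ⟨fun n => f (σ⁻¹ n), by
    have h : Memℓp (fun n => f n) 2 := f.2
    rw [memℓp_gen_iff (by norm_num)] at h
    exact memℓp_gen (h.comp_injective (σ⁻¹).injective)⟩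
  map_add' _ _ := rfl
  map_smul' _ _ := rfl

theorem norm_permLinearMap (σ : Equiv.Perm ℕ) (f : EllTwo) : ‖permLinearMap σ f‖ = ‖f‖ := by
  rw [lp.norm_eq_tsum_rpow (by norm_num), lp.norm_eq_tsum_rpow (by norm_num)]
  congr 1
  exact (σ⁻¹).tsum_eq fun n => ‖f n‖ ^ (2 : ENNReal).toReal

/-- The representation of `S_∞` by permutations of the coordinates. -/
noncomputable def permRep : Equiv.Perm ℕ →* UnitaryEllTwo where
  toFun σ :=
    { LinearEquiv.ofLinearMap (permLinearMap σ) (permLinearMap σ⁻¹)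
        (by
          ext f n
          exact congrArg f (σ⁻¹.symm_apply_apply n))
        (by
          ext f n
          exact congrArg f (σ⁻¹.apply_symm_apply n)) with
      norm_map' := norm_permLinearMap σ }
  map_one' := rfl
  map_mul' _ _ := rfl

theorem permRep_single (σ : Equiv.Perm ℕ) (n : ℕ) :
    permRep σ (lp.single 2 n (1 : ℂ)) = lp.single 2 (σ n) (1 : ℂ) := by
  ext m
  change (lp.single 2 n (1 : ℂ) : EllTwo) (σ⁻¹ m) = _
  rw [lp.single_apply, lp.single_apply]
  by_cases h : m = σ n
  · subst h; simp
  · rw [Pi.single_eq_of_ne h, Pi.single_eq_of_ne]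
    rwa [ne_eq, Equiv.Perm.inv_eq_iff_eq]

/-- On a basis vector the orbit map is locally constant. The vectors on which it is continuous at σ
form a closed subspace, which is then everything. -/
theorem continuous_permRep : Continuous permRep := by
  refine isInducing_toIso.continuous_iff.2 (continuous_iff_continuousAt.2 fun σ => ?_)
  refine IsometryEquiv.tendsto_pointwise.2 fun f => ?_
  let S : Submodule ℂ EllTwo :=
    { carrier := {x | Tendsto (fun τ => toIso (permRep τ) x) (𝓝 σ) (𝓝 (toIso (permRep σ) x))}
      add_mem' := fun {x y} hx hy => by
        simp only [Set.mem_ofPred_eq] at hx hy ⊢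
        have h := Tendsto.add hx hy
        exact h
      zero_mem' := by
        exact (tendsto_const_nhds (x := (0 : EllTwo))).congr fun τ => (permRep τ).map_zero.symm
      smul_mem' := fun c x hx => Tendsto.const_smul hx c }
  refine mem_of_isClosed_of_single S (IsometryEquiv.isClosed_tendsto_apply _ _) (fun n => ?_) f
  refine tendsto_const_nhds.congr' ?_
  filter_upwards [SInfty.tendsto_pointwise.1 tendsto_id n] with τ hτ
  change permRep σ _ = permRep τ _
  rw [permRep_single, permRep_single]
  congr 1
  exact hτ.symm

theorem hasUnboundedStabilizer : HasUnboundedStabilizer UnitaryEllTwo := by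
  have hev : Continuous fun g : UnitaryEllTwo => g (lp.single 2 0 (1 : ℂ)) :=
    (continuous_apply _).comp continuous_induced_dom
  refine hasUnboundedStabilizer_of_perm permRep continuous_permRep
    (fun g => g (lp.single 2 0 (1 : ℂ))) hev (fun n => lp.single 2 n (1 : ℂ))
    (fun σ => permRep_single σ 0) one_pos fun m n hmn => ?_
  -- The m-th coordinate of e_m − e_n is 1, which already bounds the distance below by 1.
  have h := lp.norm_apply_le_norm (E := fun _ : ℕ => ℂ) (p := 2) (by norm_num)
    (lp.single 2 m (1 : ℂ) - lp.single 2 n (1 : ℂ)) m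
  beta_reduce
  rw [dist_eq_norm]
  refine le_trans (le_of_eq ?_) h
  simp [hmn]

end UnitaryEllTwo

/-! ### Finite extension properties -/

/-- Every one-point metric extension of a finite subspace of `X` is realized in `X`. The finite
subspace and the prescribed distances to it are encoded by a finite set of pairs. -/
def HasFiniteExtension (X : Type u) [MetricSpace X] : Prop :=
  ∀ L : Finset (X × ℝ), (∀ u ∈ L, ∀ v ∈ L, dist u.1 v.1 ≤ u.2 + v.2) →
    (∀ u ∈ L, ∀ v ∈ L, u.2 ≤ v.2 + dist u.1 v.1) → ∃ p, ∀ u ∈ L, dist p u.1 = u.2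

/-- An approximate extension property: for finitely many balls whose centers are at distance at most
the sum of the radii, some point lies almost as far from the centers as the balls permit. -/
def HasApproxExtension (X : Type u) [PseudoMetricSpace X] : Prop :=
  ∀ L : Finset (X × ℝ), L.Nonempty → (∀ u ∈ L, ∀ v ∈ L, dist u.1 v.1 ≤ u.2 + v.2) →
    ∀ ε > 0, ∃ p, ∀ v ∈ L, dist p v.1 ≤ v.2 + ε ∧
      ∃ u ∈ L, u.2 + dist u.1 v.1 ≤ dist p v.1 + ε

/-- Moving the centres into the dense image changes distances by at most 2·(ε/4), and enlarging
every radius by ε/4 restores the hypothesis. An exact Lipschitz condition on the radii would not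
survive this perturbation, hence the weaker form of the approximate property. -/
theorem HasApproxExtension.of_denseRange {W : Type u} {X : Type v} [PseudoMetricSpace W]
    [PseudoMetricSpace X] {i : W → X} (hi : Isometry i) (hd : DenseRange i)
    (h : HasApproxExtension W) : HasApproxExtension X := by
  classical
  intro L hL hLd ε hε
  have hδ : 0 < ε / 4 := by positivity
  choose w hw using fun x => hd.exists_dist_lt x hδ
  have key : ∀ x y, |dist (w x) (w y) - dist x y| ≤ 2 * (ε / 4) := by
    intro x y
    rw [← hi.dist_eq]
    have h1 := hw x
    have h2 := hw y
    have h3 := dist_triangle4 (i (w x)) x y (i (w y))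
    have h4 := dist_triangle4 x (i (w x)) (i (w y)) y
    rw [dist_comm (i (w x)) x] at h3
    rw [dist_comm (i (w y)) y] at h4
    rw [abs_le]
    constructor <;> linarith
  obtain ⟨q, hq⟩ := h (L.image fun u => (w u.1, u.2 + ε / 4)) (hL.image _) (by
    simp only [Finset.mem_image, forall_exists_index, and_imp, forall_apply_eq_imp_iff₂]
    intro u hu v hv
    have := abs_le.1 (key u.1 v.1)
    linarith [hLd u hu v hv]) (ε / 4) hδ
  refine ⟨i q, fun v hv => ?_⟩
  obtain ⟨h1, u', hu', h2⟩ := hq _ (Finset.mem_image_of_mem _ hv)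
  obtain ⟨u, hu, rfl⟩ := Finset.mem_image.1 hu'
  have h3 := hw v.1
  have h4 := dist_triangle (i q) (i (w v.1)) v.1
  have h5 := dist_triangle (i q) v.1 (i (w v.1))
  rw [dist_comm (i (w v.1)) v.1] at h4
  rw [hi.dist_eq] at h4 h5
  have h6 := abs_le.1 (key u.1 v.1)
  refine ⟨by linarith, u, hu, ?_⟩
  dsimp only at h2
  linarith

theorem HasApproxExtension.hasFiniteExtension {X : Type u} [MetricSpace X] [CompleteSpace X]
    [Nonempty X] (h : HasApproxExtension X) : HasFiniteExtension X := by
  classical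
  intro L hL1 hL2
  rcases L.eq_empty_or_nonempty with rfl | hL
  · exact ⟨Classical.arbitrary X, by simp⟩
  let P : ℕ → X → Prop := fun n p => ∀ u ∈ L, |dist p u.1 - u.2| ≤ (1 / 2 : ℝ) ^ n
  have base : ∃ p, P 0 p := by
    obtain ⟨p, hp⟩ := h L hL hL1 1 one_pos
    refine ⟨p, fun v hv => ?_⟩
    obtain ⟨h1, u, hu, h2⟩ := hp v hv
    have := hL2 v hv u hu
    rw [dist_comm] at this
    rw [pow_zero, abs_le]
    constructor <;> linarith
  have step : ∀ n p, P n p → ∃ q, P (n + 1) q ∧ dist p q ≤ 2 * (1 / 2 : ℝ) ^ n := by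
    intro n p hp
    have hn : (0 : ℝ) < (1 / 2) ^ n := by positivity
    -- Successive approximation: the extra ball around p keeps the next point close, so the sequence
    -- is Cauchy.
    obtain ⟨q, hq⟩ := h (insert (p, (1 / 2 : ℝ) ^ n) L) (Finset.insert_nonempty _ _) (by
      have hpu : ∀ u ∈ L, dist p u.1 ≤ (1 / 2) ^ n + u.2 := fun u hu => by
        have := abs_le.1 (hp u hu)
        linarith
      intro u hu v hv
      rcases Finset.mem_insert.1 hu with rfl | hu <;> rcases Finset.mem_insert.1 hv with rfl | hv
      · rw [dist_self]
        positivity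
      · exact hpu v hv
      · rw [dist_comm, add_comm]
        exact hpu u hu
      · exact hL1 u hu v hv) ((1 / 2 : ℝ) ^ (n + 1)) (by positivity)
    refine ⟨q, fun v hv => ?_, ?_⟩
    · obtain ⟨h1, u, hu, h2⟩ := hq v (Finset.mem_insert_of_mem hv)
      rw [abs_le]
      refine ⟨?_, by linarith⟩
      -- If the extra ball is the one that limits d(q, v), the lower bound still holds, since 2⁻ⁿ +
      -- d(p, v) is at least the prescribed distance.
      rcases Finset.mem_insert.1 hu with rfl | hu
      · have := abs_le.1 (hp v hv)
        dsimp only at h2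
        linarith
      · have := hL2 v hv u hu
        rw [dist_comm] at this
        linarith
    · have h1 := (hq _ (Finset.mem_insert_self _ _)).1
      rw [dist_comm]
      rw [pow_succ] at h1
      dsimp only at h1
      linarith
  obtain ⟨p₀, hp₀⟩ := base
  choose! f hf using step
  let s : ℕ → X := fun n => Nat.rec p₀ f n
  have hs : ∀ n, P n (s n) := fun n => by
    induction n with
    | zero => exact hp₀
    | succ n ih => exact (hf n _ ih).1
  have hc : CauchySeq s := cauchySeq_of_le_geometric (1 / 2) 2 (by norm_num)
    fun n => (hf n _ (hs n)).2
  obtain ⟨p, hp⟩ := cauchySeq_tendsto_of_complete hc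
  refine ⟨p, fun u hu => ?_⟩
  have h1 : Tendsto (fun n => |dist (s n) u.1 - u.2|) atTop (𝓝 |dist p u.1 - u.2|) :=
    ((hp.dist tendsto_const_nhds).sub_const _).abs
  have h2 := le_of_tendsto_of_tendsto' h1
    (tendsto_pow_atTop_nhds_zero_of_lt_one (by norm_num : (0 : ℝ) ≤ 1 / 2) (by norm_num))
    fun n => hs n u hu
  exact sub_eq_zero.1 (abs_eq_zero.1 (le_antisymm h2 (abs_nonneg _)))

theorem HasFiniteExtension.nonempty {X : Type u} [MetricSpace X] (h : HasFiniteExtension X) :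
    Nonempty X := by
  obtain ⟨p, -⟩ := h ∅ (by simp) (by simp)
  exact ⟨p⟩

/-- The extension lives in ℝ^A with the sup metric: embed A by a ↦ d(a, ·), and take the function t
of prescribed distances as the new point. Universality places this in U, and ultrahomogeneity moves
the copy of A back onto A. -/
theorem IsUrysohnSpace.hasFiniteExtension {U : Type} [MetricSpace U] (hU : IsUrysohnSpace U) :
    HasFiniteExtension U := by
  classical
  intro L hL1 hL2
  let A : Finset U := L.image Prod.fst
  have hA : ∀ a : A, ∃ t : ℝ, ((a : U), t) ∈ L := fun a => by
    obtain ⟨u, hu, hua⟩ := Finset.mem_image.1 a.2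
    exact ⟨u.2, by rwa [← hua]⟩
  choose t ht using hA
  obtain ⟨F, hF⟩ := hU.universal (A → ℝ)
  let κ : A → (A → ℝ) := fun a b => dist a b
  have hκ : Isometry κ := Isometry.of_dist_eq fun a b => by
    refine le_antisymm ((dist_pi_le_iff dist_nonneg).2 fun c => ?_) ?_
    · exact abs_dist_sub_le _ _ _
    · have := dist_le_pi_dist (κ a) (κ b) b
      simpa [κ, Real.dist_eq] using this
  obtain ⟨g, hg⟩ := hU.ultrahomogeneous A (fun a => F (κ a)) (hF.comp hκ)
  refine ⟨g.symm (F t), fun u hu => ?_⟩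
  let a : A := ⟨u.1, Finset.mem_image_of_mem _ hu⟩
  -- Two constraints at the same centre agree, by the Lipschitz hypothesis at distance zero.
  have hta : t a = u.2 := by
    have h1 := hL2 _ (ht a) _ hu
    have h2 := hL2 _ hu _ (ht a)
    simp only [a, dist_self] at h1 h2
    exact le_antisymm (by simpa using h1) (by simpa using h2)
  have h1 : dist (g.symm (F t)) u.1 = dist t (κ a) := by
    rw [← g.dist_eq, g.apply_symm_apply, ← hF.dist_eq]
    exact congrArg _ (hg a)
  have h0 : ∀ b, 0 ≤ t b := fun b => by
    have := hL1 _ (ht b) _ (ht b)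
    rw [dist_self] at this
    dsimp only at this
    linarith
  rw [h1, ← hta]
  refine le_antisymm ((dist_pi_le_iff (h0 a)).2 fun b => ?_) ?_
  · have h2 := hL1 _ (ht a) _ (ht b)
    have h3 := hL2 _ (ht a) _ (ht b)
    have h4 := hL2 _ (ht b) _ (ht a)
    rw [dist_comm] at h4
    rw [Real.dist_eq, abs_le]
    change -t a ≤ t b - dist (a : U) b ∧ t b - dist (a : U) b ≤ t a
    constructor <;> dsimp only at h2 h3 h4 <;> linarith
  · have := dist_le_pi_dist t (κ a) a
    rwa [Real.dist_eq, show κ a a = 0 from dist_self _, sub_zero, abs_of_nonneg (h0 a)] at this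

/-! ### Back and forth -/

/-- Finite partial isometries between two metric spaces. -/
abbrev FinitePartialIsometry (X : Type u) (Y : Type v) [MetricSpace X] [MetricSpace Y] :=
  {R : Finset (X × Y) // DistPreserving (R : Set (X × Y))}

namespace FinitePartialIsometry

variable {X : Type u} {Y : Type v} [MetricSpace X] [MetricSpace Y]

theorem exists_extend_fst (hY : HasFiniteExtension Y) (R : FinitePartialIsometry X Y) (x : X) :
    ∃ S : FinitePartialIsometry X Y, (∃ p ∈ S.1, p.1 = x) ∧ R ≤ S := by
  classical
  obtain ⟨R, hR⟩ := R
  obtain ⟨y, hy⟩ := hY (R.image fun p => (p.2, dist x p.1))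
    (by
      simp only [Finset.mem_image, forall_exists_index, and_imp, forall_apply_eq_imp_iff₂]
      intro p hp q hq
      rw [← hR p hp q hq]
      exact dist_triangle_left _ _ _)
    (by
      simp only [Finset.mem_image, forall_exists_index, and_imp, forall_apply_eq_imp_iff₂]
      intro p hp q hq
      rw [← hR p hp q hq, dist_comm p.1]
      exact dist_triangle _ _ _)
  have hy' : ∀ p ∈ R, dist x p.1 = dist y p.2 := fun p hp =>
    (hy _ (Finset.mem_image_of_mem _ hp)).symm
  refine ⟨⟨insert (x, y) R, ?_⟩, ⟨(x, y), Finset.mem_insert_self _ _, rfl⟩,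
    Finset.subset_insert _ _⟩
  intro p hp q hq
  rcases Finset.mem_insert.1 hp with rfl | hp <;> rcases Finset.mem_insert.1 hq with rfl | hq
  · simp
  · exact hy' q hq
  · rw [dist_comm, dist_comm p.2]
    exact hy' p hp
  · exact hR p hp q hq

theorem exists_extend_snd (hX : HasFiniteExtension X) (R : FinitePartialIsometry X Y) (y : Y) :
    ∃ S : FinitePartialIsometry X Y, (∃ p ∈ S.1, p.2 = y) ∧ R ≤ S := by
  classical
  have hsw : ∀ {X : Type u} {Y : Type v} [MetricSpace X] [MetricSpace Y] {R : Finset (X × Y)},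
      DistPreserving (R : Set (X × Y)) →
      DistPreserving ((R.image Prod.swap : Finset (Y × X)) : Set (Y × X)) := fun h => by
    rw [Finset.coe_image]
    exact h.swap
  obtain ⟨S, ⟨p, hp, hpy⟩, hRS⟩ := exists_extend_fst hX ⟨R.1.image Prod.swap, hsw R.2⟩ y
  refine ⟨⟨S.1.image Prod.swap, ?_⟩, ⟨p.swap, Finset.mem_image_of_mem _ hp, hpy⟩, fun q hq => ?_⟩
  · rw [Finset.coe_image]
    exact S.2.swap
  · exact Finset.mem_image.2 ⟨q.swap, hRS (Finset.mem_image_of_mem _ hq), Prod.swap_swap q⟩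

/-- A finite partial isometry extends to a distance-preserving relation meeting countably many
cofinal families. -/
theorem exists_generic (R : FinitePartialIsometry X Y) {ι : Type*} [Encodable ι]
    (𝒟 : ι → Order.Cofinal (FinitePartialIsometry X Y)) :
    ∃ T : Set (X × Y), DistPreserving T ∧ (R.1 : Set (X × Y)) ⊆ T ∧
      ∀ i, ∃ S ∈ 𝒟 i, (S.1 : Set (X × Y)) ⊆ T := by
  let I := Order.idealOfCofinals R 𝒟
  refine ⟨{p | ∃ S ∈ I, p ∈ S.1}, ?_, fun p hp => ⟨R, Order.mem_idealOfCofinals R 𝒟, hp⟩,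
    fun i => ?_⟩
  · rintro p ⟨S, hS, hp⟩ q ⟨S', hS', hq⟩
    obtain ⟨Q, -, h1, h2⟩ := I.directed S hS S' hS'
    exact Q.2 p (h1 hp) q (h2 hq)
  · obtain ⟨S, hS, hSI⟩ := Order.cofinal_meets_idealOfCofinals R 𝒟 i
    exact ⟨S, hS, fun p hp => ⟨S, hSI, hp⟩⟩

/-- Back and forth: the cofinal families demand that each point of a dense sequence of X enter the
domain and each point of one of Y enter the range. The resulting relation extends by completeness.
-/
theorem exists_isometryEquiv [CompleteSpace X] [CompleteSpace Y]
    [TopologicalSpace.SeparableSpace X] [TopologicalSpace.SeparableSpace Y]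
    (hX : HasFiniteExtension X) (hY : HasFiniteExtension Y) (R : FinitePartialIsometry X Y) :
    ∃ f : X ≃ᵢ Y, ∀ p ∈ R.1, f p.1 = p.2 := by
  have := hX.nonempty
  have := hY.nonempty
  let 𝒟 : ℕ ⊕ ℕ → Order.Cofinal (FinitePartialIsometry X Y) := Sum.elim
    (fun n => ⟨{S | ∃ p ∈ S.1, p.1 = TopologicalSpace.denseSeq X n},
      fun S => exists_extend_fst hY S _⟩)
    (fun n => ⟨{S | ∃ p ∈ S.1, p.2 = TopologicalSpace.denseSeq Y n},
      fun S => exists_extend_snd hX S _⟩)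
  obtain ⟨T, hT, hRT, hD⟩ := exists_generic R 𝒟
  obtain ⟨f, hf⟩ := hT.exists_isometryEquiv
    ((TopologicalSpace.denseRange_denseSeq X).mono (by
      rintro _ ⟨n, rfl⟩
      obtain ⟨S, ⟨p, hp, hpn⟩, hST⟩ := hD (Sum.inl n)
      exact ⟨p, hST hp, hpn⟩))
    ((TopologicalSpace.denseRange_denseSeq Y).mono (by
      rintro _ ⟨n, rfl⟩
      obtain ⟨S, ⟨p, hp, hpn⟩, hST⟩ := hD (Sum.inr n)
      exact ⟨p, hST hp, hpn⟩))
  exact ⟨f, fun p hp => hf p (hRT hp)⟩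

theorem exists_isometry [CompleteSpace Y] [TopologicalSpace.SeparableSpace X]
    (hY : HasFiniteExtension Y) : ∃ f : X → Y, Isometry f := by
  rcases isEmpty_or_nonempty X with hX | hX
  · exact ⟨fun x => hX.elim x, fun x => hX.elim x⟩
  let 𝒟 : ℕ → Order.Cofinal (FinitePartialIsometry X Y) :=
    fun n => ⟨{S | ∃ p ∈ S.1, p.1 = TopologicalSpace.denseSeq X n},
      fun S => exists_extend_fst hY S _⟩
  obtain ⟨T, hT, -, hD⟩ := exists_generic ⟨∅, by simp [DistPreserving]⟩ 𝒟
  obtain ⟨f, hf, -⟩ := hT.exists_isometry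
    ((TopologicalSpace.denseRange_denseSeq X).mono (by
      rintro _ ⟨n, rfl⟩
      obtain ⟨S, ⟨p, hp, hpn⟩, hST⟩ := hD n
      exact ⟨p, hST hp, hpn⟩))
  exact ⟨f, hf⟩

end FinitePartialIsometry

theorem HasFiniteExtension.isUrysohnSpace {U : Type} [MetricSpace U] [hc : CompleteSpace U]
    [hs : TopologicalSpace.SeparableSpace U] (h : HasFiniteExtension U) : IsUrysohnSpace U where
  complete := hc
  separable := hs
  universal _ _ _ := FinitePartialIsometry.exists_isometry h
  ultrahomogeneous A f hf := by
    classical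
    obtain ⟨g, hg⟩ := FinitePartialIsometry.exists_isometryEquiv h h
      ⟨A.attach.image fun a : A => ((a : U), f a), by
        intro p hp q hq
        obtain ⟨a, -, rfl⟩ := Finset.mem_image.1 hp
        obtain ⟨b, -, rfl⟩ := Finset.mem_image.1 hq
        exact (hf.dist_eq a b).symm⟩
    exact ⟨g, fun a => hg _ (Finset.mem_image_of_mem _ (Finset.mem_attach A a))⟩

/-- Urysohn spaces with a base point are isometric. -/
theorem IsUrysohnSpace.exists_isometryEquiv {U V : Type} [MetricSpace U] [MetricSpace V]
    (hU : IsUrysohnSpace U) (hV : IsUrysohnSpace V) (c : U) (c' : V) :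
    ∃ f : U ≃ᵢ V, f c = c' := by
  have := hU.complete
  have := hU.separable
  have := hV.complete
  have := hV.separable
  obtain ⟨f, hf⟩ := FinitePartialIsometry.exists_isometryEquiv hU.hasFiniteExtension
    hV.hasFiniteExtension ⟨{(c, c')}, by simp [DistPreserving]⟩
  exact ⟨f, hf _ (Finset.mem_singleton_self _)⟩

/-! ### Katětov functions with finite rational support -/

/-- `f` is the least Lipschitz extension of the finitely many rational constraints in `L`. -/
def IsSupportedOn {X : Type u} [MetricSpace X] (f : X → ℝ) (L : Finset (X × ℚ)) : Prop :=
  ∀ x, (∀ u ∈ L, f x ≤ u.2 + dist u.1 x) ∧ ∃ u ∈ L, f x = u.2 + dist u.1 x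

/-- Katětov functions with a finite rational support. -/
def Katetov (X : Type u) [MetricSpace X] : Type u :=
  {f : X → ℝ // (∀ x y, dist x y ≤ f x + f y) ∧ ∃ L, IsSupportedOn f L}

theorem IsSupportedOn.le_add_dist {X : Type u} [MetricSpace X] {f : X → ℝ} {L : Finset (X × ℚ)}
    (h : IsSupportedOn f L) (x y : X) : f x ≤ f y + dist x y := by
  obtain ⟨u, hu, huy⟩ := (h y).2
  have := (h x).1 u hu
  have := dist_triangle_right u.1 x y
  linarith

theorem IsSupportedOn.unique {X : Type u} [MetricSpace X] {f g : X → ℝ} {L : Finset (X × ℚ)}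
    (hf : IsSupportedOn f L) (hg : IsSupportedOn g L) : f = g := by
  funext x
  obtain ⟨u, hu, hux⟩ := (hf x).2
  obtain ⟨v, hv, hvx⟩ := (hg x).2
  exact le_antisymm (hvx ▸ (hf x).1 v hv) (hux ▸ (hg x).1 u hu)

namespace Katetov

variable {X : Type u} [MetricSpace X]

instance : CoeFun (Katetov X) fun _ => X → ℝ := ⟨Subtype.val⟩

theorem ext {f g : Katetov X} (h : ∀ x, f x = g x) : f = g := Subtype.ext (funext h)

theorem dist_le_add (f : Katetov X) (x y : X) : dist x y ≤ f x + f y := f.2.1 x y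

theorem le_add_dist (f : Katetov X) (x y : X) : f x ≤ f y + dist x y := by
  obtain ⟨L, hL⟩ := f.2.2
  exact hL.le_add_dist x y

theorem nonneg (f : Katetov X) (x : X) : 0 ≤ f x := by
  have := f.dist_le_add x x
  rw [dist_self] at this
  linarith

theorem abs_sub_le_add (f g : Katetov X) (x y : X) : |f x - g x| ≤ f y + g y := by
  have h1 := f.le_add_dist x y
  have h2 := g.le_add_dist x y
  have h3 := f.dist_le_add x y
  have h4 := g.dist_le_add x y
  rw [abs_le]
  constructor <;> linarith

theorem bddAbove_range (f g : Katetov X) : BddAbove (Set.range fun x => |f x - g x|) := by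
  rcases isEmpty_or_nonempty X with hX | ⟨⟨y⟩⟩
  · rw [Set.range_eq_empty]
    exact bddAbove_empty
  · exact ⟨f y + g y, by rintro _ ⟨x, rfl⟩; exact abs_sub_le_add f g x y⟩

noncomputable instance : Dist (Katetov X) := ⟨fun f g => ⨆ x, |f x - g x|⟩

theorem abs_sub_le_dist (f g : Katetov X) (x : X) : |f x - g x| ≤ dist f g :=
  le_ciSup (bddAbove_range f g) x

theorem dist_le {f g : Katetov X} {C : ℝ} (hC : 0 ≤ C) (h : ∀ x, |f x - g x| ≤ C) :
    dist f g ≤ C := Real.iSup_le h hC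

theorem dist_nonneg' (f g : Katetov X) : 0 ≤ dist f g := Real.iSup_nonneg fun _ => abs_nonneg _

noncomputable instance : MetricSpace (Katetov X) where
  dist_self f := le_antisymm (dist_le le_rfl fun x => by simp) (dist_nonneg' f f)
  dist_comm f g := by
    change (⨆ x, |f x - g x|) = ⨆ x, |g x - f x|
    simp only [abs_sub_comm]
  dist_triangle f g h := dist_le (add_nonneg (dist_nonneg' _ _) (dist_nonneg' _ _)) fun x =>
    (abs_sub_le _ (g x) _).trans (add_le_add (abs_sub_le_dist f g x) (abs_sub_le_dist g h x))
  eq_of_dist_eq_zero {f g} h := ext fun x => by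
    have := abs_sub_le_dist f g x
    rw [h] at this
    exact sub_eq_zero.1 (abs_eq_zero.1 (le_antisymm this (abs_nonneg _)))

/-- The point `x`, as the distance function from `x`. -/
def of (x : X) : Katetov X :=
  ⟨fun y => dist x y, fun _ _ => dist_triangle_left _ _ _, {(x, 0)}, fun y => by simp⟩

theorem of_apply (x y : X) : of x y = dist x y := rfl

/-- Thus f, viewed as a new point, lies at distance exactly f x from each old point x. -/
theorem dist_of (f : Katetov X) (x : X) : dist f (of x) = f x := by
  refine le_antisymm (dist_le (f.nonneg x) fun y => ?_) ?_
  · simpa [of_apply] using abs_sub_le_add f (of x) y x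
  · have := abs_sub_le_dist f (of x) x
    rwa [of_apply, dist_self, sub_zero, abs_of_nonneg (f.nonneg x)] at this

theorem isometry_of : Isometry (of : X → Katetov X) :=
  Isometry.of_dist_eq fun x y => by rw [dist_of, of_apply]

/-- A finite set of rational constraints determines the function; this is why the supports are
finite and rational. -/
instance [Countable X] : Countable (Katetov X) := by
  choose L hL using fun f : Katetov X => f.2.2
  exact Function.Injective.countable (f := L) fun f g h =>
    Subtype.ext ((hL f).unique (h ▸ hL g))

theorem exists_realize (L : Finset (X × ℝ)) (hL : L.Nonempty)
    (h : ∀ u ∈ L, ∀ v ∈ L, dist u.1 v.1 ≤ u.2 + v.2) {ε : ℝ} (hε : 0 < ε) :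
    ∃ f : Katetov X, ∀ x, (∀ u ∈ L, f x ≤ u.2 + ε + dist u.1 x) ∧
      ∃ u ∈ L, u.2 + dist u.1 x ≤ f x := by
  classical
  -- Radii are rounded up to rationals, so the balls still satisfy the distance condition.
  choose q hq1 hq2 using fun t : ℝ => exists_rat_btwn (lt_add_of_pos_right t hε)
  let M : Finset (X × ℚ) := L.image fun u => (u.1, q u.2)
  have hM : M.Nonempty := hL.image _
  let f : X → ℝ := fun x => M.inf' hM fun u => (u.2 : ℝ) + dist u.1 x
  have hf : IsSupportedOn f M := fun x => ⟨fun u hu => Finset.inf'_le _ hu,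
    Finset.exists_mem_eq_inf' hM _⟩
  have hlow : ∀ x, ∃ u ∈ L, u.2 + dist u.1 x ≤ f x := fun x => by
    obtain ⟨v, hv, hvx⟩ := (hf x).2
    obtain ⟨u, hu, rfl⟩ := Finset.mem_image.1 hv
    refine ⟨u, hu, ?_⟩
    rw [hvx]
    dsimp only
    linarith [hq1 u.2]
  refine ⟨⟨f, fun x y => ?_, M, hf⟩, fun x => ⟨fun u hu => ?_, hlow x⟩⟩
  · obtain ⟨u, hu, hux⟩ := hlow x
    obtain ⟨v, hv, hvy⟩ := hlow y
    have h1 := h u hu v hv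
    have h2 := dist_triangle4 x u.1 v.1 y
    rw [dist_comm x u.1] at h2
    linarith
  · have := (hf x).1 _ (Finset.mem_image_of_mem _ hu)
    dsimp only at this ⊢
    linarith [hq2 u.2]

section Action

variable {H : Type v} [Group H] [MulAction H X] [IsIsometricSMul H X]

theorem isSupportedOn_smul [DecidableEq X] {f : X → ℝ} {L : Finset (X × ℚ)}
    (h : IsSupportedOn f L) (σ : H) :
    IsSupportedOn (fun x => f (σ⁻¹ • x)) (L.image fun u => (σ • u.1, u.2)) := by
  intro x
  have hd : ∀ y, dist (σ • y) x = dist y (σ⁻¹ • x) := fun y => by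
    rw [← dist_smul σ y, smul_inv_smul]
  constructor
  · intro v hv
    obtain ⟨u, hu, rfl⟩ := Finset.mem_image.1 hv
    rw [hd]
    exact (h _).1 u hu
  · obtain ⟨u, hu, hux⟩ := (h (σ⁻¹ • x)).2
    exact ⟨_, Finset.mem_image_of_mem _ hu, by rw [hd]; exact hux⟩

instance : SMul H (Katetov X) :=
  ⟨fun σ f => ⟨fun x => f (σ⁻¹ • x), fun x y => by
    rw [← dist_smul σ⁻¹ x y]
    exact f.dist_le_add _ _, by
    classical
    obtain ⟨L, hL⟩ := f.2.2
    exact ⟨_, isSupportedOn_smul hL σ⟩⟩⟩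

theorem smul_apply (σ : H) (f : Katetov X) (x : X) : (σ • f) x = f (σ⁻¹ • x) := rfl

instance : MulAction H (Katetov X) where
  one_smul f := ext fun x => by simp [smul_apply]
  mul_smul σ τ f := ext fun x => by simp [smul_apply, mul_smul]

theorem dist_smul_le (σ : H) (f g : Katetov X) : dist (σ • f) (σ • g) ≤ dist f g :=
  dist_le dist_nonneg fun x => abs_sub_le_dist f g (σ⁻¹ • x)

instance : IsIsometricSMul H (Katetov X) :=
  ⟨fun σ => Isometry.of_dist_eq fun f g => le_antisymm (dist_smul_le σ f g) (by
    simpa using dist_smul_le σ⁻¹ (σ • f) (σ • g))⟩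

theorem smul_of (σ : H) (x : X) : σ • of x = of (σ • x) := ext fun y => by
  rw [smul_apply, of_apply, of_apply, ← dist_smul σ, smul_inv_smul]

/-- An element fixing the finite support pointwise fixes f, so open stabilizers pass to the next
stage of the tower. -/
theorem eventually_smul_eq {l : Filter H} (h : ∀ x : X, ∀ᶠ σ in l, σ • x = x) (f : Katetov X) :
    ∀ᶠ σ in l, σ • f = f := by
  classical
  obtain ⟨L, hL⟩ := f.2.2
  have h1 : ∀ᶠ σ in l, ∀ u ∈ L, σ • u.1 = u.1 := (Finset.eventually_all L).2 fun u _ => h u.1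
  filter_upwards [h1] with σ hσ
  have h2 : L.image (fun u => (σ • u.1, u.2)) = L := by
    conv_rhs => rw [← Finset.image_id (s := L)]
    exact Finset.image_congr fun u hu => Prod.ext (hσ u hu) rfl
  have h3 := isSupportedOn_smul hL σ
  rw [h2] at h3
  exact Subtype.ext (h3.unique hL)

end Action

end Katetov

/-! ### The Katětov tower -/

/-- A countable metric space with an isometric action all of whose stabilizers are open. -/
structure CountableMetricAction (H : Type v) [Group H] [TopologicalSpace H] where
  /-- The underlying space. -/
  carrier : Type
  [metricSpace : MetricSpace carrier]
  [countable : Countable carrier]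
  [mulAction : MulAction H carrier]
  [isIsometricSMul : IsIsometricSMul H carrier]
  eventually_smul_eq : ∀ x : carrier, ∀ᶠ σ : H in 𝓝 1, σ • x = x

namespace CountableMetricAction

attribute [instance] metricSpace countable mulAction isIsometricSMul

variable {H : Type v} [Group H] [TopologicalSpace H]

/-- The action on Katětov functions. -/
noncomputable def next (s : CountableMetricAction H) : CountableMetricAction H where
  carrier := Katetov s.carrier
  eventually_smul_eq := Katetov.eventually_smul_eq s.eventually_smul_eq

/-- Iterated Katětov functions. -/
noncomputable def tower (s : CountableMetricAction H) : ℕ → CountableMetricAction H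
  | 0 => s
  | n + 1 => (tower s n).next

variable (s : CountableMetricAction H)

/-- The inclusion of a stage of the tower into the next one. -/
noncomputable def incl (n : ℕ) : (s.tower n).carrier → (s.tower (n + 1)).carrier :=
  fun x => (Katetov.of x : Katetov (s.tower n).carrier)

theorem isometry_incl (n : ℕ) : Isometry (s.incl n) := Katetov.isometry_of

theorem smul_incl (n : ℕ) (σ : H) (x : (s.tower n).carrier) :
    σ • s.incl n x = s.incl n (σ • x) := Katetov.smul_of σ x

/-- The inclusion of a stage of the tower into a later one. -/
noncomputable def lift {n m : ℕ} (h : n ≤ m) (x : (s.tower n).carrier) : (s.tower m).carrier :=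
  Nat.leRecOn (C := fun k => (s.tower k).carrier) h (fun {k} => s.incl k) x

theorem lift_succ {n m : ℕ} (h : n ≤ m) (x : (s.tower n).carrier) :
    s.lift (h.trans m.le_succ) x = s.incl m (s.lift h x) :=
  Nat.leRecOn_succ (C := fun k => (s.tower k).carrier) (next := fun {k} => s.incl k) h x

theorem lift_self {n : ℕ} (x : (s.tower n).carrier) : s.lift le_rfl x = x :=
  Nat.leRecOn_self (C := fun k => (s.tower k).carrier) (next := fun {k} => s.incl k) x

theorem smul_lift {n m : ℕ} (h : n ≤ m) (σ : H) (x : (s.tower n).carrier) :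
    σ • s.lift h x = s.lift h (σ • x) := by
  induction m, h using Nat.le_induction with
  | base => rw [lift_self, lift_self]
  | succ m h ih => rw [lift_succ s h, lift_succ s h, smul_incl, ih]

/-- The union of the Katětov tower. -/
def Limit : Type := Σ n, (s.tower n).carrier

/-- The inclusion of a stage of the tower into the union. -/
def toLimit (n : ℕ) (x : (s.tower n).carrier) : s.Limit := ⟨n, x⟩

/-- Copies of a point in different stages are at distance zero; the Hausdorff completion identifies
them. -/
noncomputable instance : PseudoMetricSpace s.Limit := Metric.inductivePremetric s.isometry_incl

theorem dist_eq_dist_lift (x y : s.Limit) (m : ℕ) (hx : x.1 ≤ m) (hy : y.1 ≤ m) :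
    dist x y = dist (s.lift hx x.2) (s.lift hy y.2) :=
  Metric.inductiveLimitDist_eq_dist s.isometry_incl x y m hx hy

instance : Countable s.Limit := inferInstanceAs (Countable (Σ n, (s.tower n).carrier))

noncomputable instance : MulAction H s.Limit where
  smul σ x := ⟨x.1, σ • x.2⟩
  one_smul x := Sigma.ext rfl (heq_of_eq (one_smul H x.2))
  mul_smul σ τ x := Sigma.ext rfl (heq_of_eq (mul_smul σ τ x.2))

instance : IsIsometricSMul H s.Limit :=
  ⟨fun σ => Isometry.of_dist_eq fun x y => by
    obtain ⟨n, x⟩ := x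
    obtain ⟨m, y⟩ := y
    change dist (s.toLimit n (σ • x)) (s.toLimit m (σ • y)) = dist (s.toLimit n x) (s.toLimit m y)
    rw [dist_eq_dist_lift s _ _ _ (le_max_left n m) (le_max_right n m),
      dist_eq_dist_lift s _ _ _ (le_max_left n m) (le_max_right n m)]
    simp only [toLimit]
    rw [← smul_lift, ← smul_lift, dist_smul]⟩

instance : UniformContinuousConstSMul H s.Limit :=
  ⟨fun σ => (isometry_smul s.Limit σ).uniformContinuous⟩

/-- Finitely many centres lie in a common stage N, and a Katětov function on that stage is a point
of stage N+1 with the required distances. -/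
theorem hasApproxExtension : HasApproxExtension s.Limit := by
  classical
  intro L hL hLd ε hε
  let N : ℕ := L.sup fun u => u.1.1
  have hN : ∀ u ∈ L, u.1.1 ≤ N := fun u hu => Finset.le_sup (f := fun u => u.1.1) hu
  -- Only values at centres in L matter; elsewhere the value is arbitrary.
  let up : s.Limit → (s.tower N).carrier := fun x =>
    if h : x.1 ≤ N then s.lift h x.2 else Nonempty.some (by
      obtain ⟨u, hu⟩ := hL
      exact ⟨s.lift (hN u hu) u.1.2⟩)
  have hup : ∀ u ∈ L, ∀ v ∈ L, dist u.1 v.1 = dist (up u.1) (up v.1) := fun u hu v hv => by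
    simp only [up, dif_pos (hN u hu), dif_pos (hN v hv)]
    exact dist_eq_dist_lift s _ _ _ _ _
  obtain ⟨f, hf⟩ := Katetov.exists_realize (L.image fun u => (up u.1, u.2)) (hL.image _) (by
    simp only [Finset.mem_image, forall_exists_index, and_imp, forall_apply_eq_imp_iff₂]
    intro u hu v hv
    rw [← hup u hu v hv]
    exact hLd u hu v hv) hε
  let p : s.Limit := s.toLimit (N + 1) f
  have hp : ∀ v ∈ L, dist p v.1 = f (up v.1) := fun v hv => by
    have h1 : s.lift (le_refl (N + 1)) p.2 = p.2 := s.lift_self p.2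
    refine (dist_eq_dist_lift s p v.1 (N + 1) le_rfl ((hN v hv).trans N.le_succ)).trans
      ((congrArg₂ dist h1 (lift_succ s (hN v hv) v.1.2)).trans ?_)
    simp only [up, dif_pos (hN v hv)]
    exact Katetov.dist_of f _
  refine ⟨p, fun v hv => ?_⟩
  obtain ⟨h1, u', hu', h2⟩ := hf (up v.1)
  obtain ⟨u, hu, rfl⟩ := Finset.mem_image.1 hu'
  rw [hp v hv]
  refine ⟨?_, u, hu, ?_⟩
  · simpa using h1 _ (Finset.mem_image_of_mem _ hv)
  · rw [hup u hu v hv]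
    dsimp only at h2
    linarith

/-- The completed union of the Katětov tower. -/
abbrev Urysohn : Type := UniformSpace.Completion s.Limit

theorem isUrysohnSpace [Nonempty s.carrier] : IsUrysohnSpace s.Urysohn := by
  have : Nonempty s.Urysohn :=
    ‹Nonempty s.carrier›.map fun x => ((s.toLimit 0 x : s.Limit) : s.Urysohn)
  have : TopologicalSpace.SeparableSpace s.Urysohn :=
    UniformSpace.Completion.denseRange_coe.separableSpace
      (UniformSpace.Completion.continuous_coe s.Limit)
  exact (s.hasApproxExtension.of_denseRange UniformSpace.Completion.coe_isometry
    UniformSpace.Completion.denseRange_coe).hasFiniteExtension.isUrysohnSpace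

/-- The extension of the action to the completed union of the Katětov tower. -/
noncomputable def rep : H →* (s.Urysohn ≃ᵢ s.Urysohn) where
  toFun σ := IsometryEquiv.mk (MulAction.toPerm σ)
    (Isometry.completion_map (isometry_smul s.Limit σ))
  map_one' := IsometryEquiv.ext fun x => one_smul H x
  map_mul' σ τ := IsometryEquiv.ext fun x => mul_smul σ τ x

theorem rep_coe (σ : H) (n : ℕ) (x : (s.tower n).carrier) :
    s.rep σ (s.toLimit n x : s.Urysohn) = (s.toLimit n (σ • x) : s.Urysohn) :=
  (UniformSpace.Completion.coe_smul σ (s.toLimit n x)).symm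

/-- For a homomorphism, continuity at 1 suffices, and convergence there is tested on the dense
union, where stabilizers are open. -/
theorem continuous_rep [IsTopologicalGroup H] : Continuous s.rep := by
  refine continuous_of_continuousAt_one _ ?_
  rw [ContinuousAt, map_one]
  refine IsometryEquiv.tendsto_of_dense (UniformSpace.Completion.denseRange_coe (α := s.Limit)) ?_
  rintro _ ⟨⟨n, x⟩, rfl⟩
  refine tendsto_const_nhds.congr' ?_
  filter_upwards [(s.tower n).eventually_smul_eq x] with σ hσ
  change (s.toLimit n x : s.Urysohn) = s.rep σ (s.toLimit n x : s.Urysohn)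
  rw [rep_coe, hσ]

end CountableMetricAction

/-! ### Spheres in the Urysohn space -/

/-- The metric on `Option ℕ` all of whose non-zero distances are `r`. -/
noncomputable abbrev equilateralMetric {r : ℝ} (hr : 0 < r) : MetricSpace (Option ℕ) where
  dist x y := if x = y then 0 else r
  dist_self x := if_pos rfl
  dist_comm x y := by simp only [eq_comm]
  dist_triangle x y z := by
    by_cases h1 : x = y <;> by_cases h2 : y = z <;> by_cases h3 : x = z <;> simp_all <;> linarith
  eq_of_dist_eq_zero {x y} h := by
    by_contra hne
    exact hr.ne' ((if_neg hne).symm.trans h)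

/-- `S_∞` acting on an equilateral space, with one fixed point. -/
noncomputable def equilateralAction {r : ℝ} (hr : 0 < r) :
    CountableMetricAction (Equiv.Perm ℕ) :=
  letI : MetricSpace (Option ℕ) := equilateralMetric hr
  letI : MulAction (Equiv.Perm ℕ) (Option ℕ) :=
    { smul := fun σ x => x.map σ
      one_smul := fun x => congrFun Option.map_id x
      mul_smul := fun σ τ x => (Option.map_map σ τ x).symm }
  { carrier := Option ℕ
    isIsometricSMul := ⟨fun σ => Isometry.of_dist_eq fun x y => by
      change (if x.map σ = y.map σ then (0 : ℝ) else r) = if x = y then 0 else r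
      simp only [(Option.map_injective σ.injective).eq_iff]⟩
    eventually_smul_eq := fun x => by
      cases x with
      | none => exact Eventually.of_forall fun σ => rfl
      | some n =>
        filter_upwards [SInfty.tendsto_pointwise.1 tendsto_id n] with σ hσ
        exact congrArg some hσ }

/-- A Urysohn space with an action of `S_∞` which permutes a sequence of equidistant points on a
sphere around a fixed point. -/
theorem exists_isUrysohnSpace_rep {r : ℝ} (hr : 0 < r) :
    ∃ (U : Type) (_ : MetricSpace U), IsUrysohnSpace U ∧ ∃ φ : Equiv.Perm ℕ →* (U ≃ᵢ U),
      Continuous φ ∧ ∃ (c : U) (e : ℕ → U), (∀ σ, φ σ c = c) ∧ (∀ σ n, φ σ (e n) = e (σ n)) ∧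
        (∀ n, dist (e n) c = r) ∧ Pairwise fun m n => dist (e m) (e n) = r := by
  -- The fixed point `none` becomes the centre, and the points `some n` become the permuted points
  -- of the sphere.
  let s := equilateralAction hr
  let i : Option ℕ → s.Urysohn := fun x => (s.toLimit 0 x : s.Limit)
  have : Nonempty s.carrier := ⟨(none : Option ℕ)⟩
  have hi : ∀ x y, x ≠ y → dist (i x) (i y) = r := fun x y hxy => by
    rw [UniformSpace.Completion.dist_eq]
    refine (s.dist_eq_dist_lift (s.toLimit 0 x) (s.toLimit 0 y) 0 le_rfl le_rfl).trans ?_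
    refine (congrArg₂ dist (s.lift_self (n := 0) x) (s.lift_self (n := 0) y)).trans ?_
    exact if_neg hxy
  have hσ : ∀ σ x, s.rep σ (i x) = i (x.map σ) := fun σ x => s.rep_coe σ 0 x
  exact ⟨s.Urysohn, inferInstance, s.isUrysohnSpace, s.rep, s.continuous_rep, i none,
    fun n => i (some n), fun σ => hσ σ none, fun σ n => hσ σ (some n),
    fun n => hi _ _ (Option.some_ne_none n),
    fun m n hmn => hi _ _ fun h => hmn (Option.some_injective _ h)⟩

/-- A homomorphism into the isometries of `U`, transported along an isometry `U ≃ᵢ V` and restricted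
to a sphere around a fixed point. -/
def sphereRep {H : Type*} [Group H] {U V : Type*} [MetricSpace U] [MetricSpace V] (f : U ≃ᵢ V)
    (φ : H →* (U ≃ᵢ U)) (c : V) (hc : ∀ σ, φ σ (f.symm c) = f.symm c) (r : ℝ) :
    H →* (Metric.sphere c r ≃ᵢ Metric.sphere c r) :=
  have hmem : ∀ σ, ∀ x : Metric.sphere c r, f (φ σ (f.symm x)) ∈ Metric.sphere c r := by
    intro σ x
    rw [Metric.mem_sphere, ← f.symm.dist_eq, f.symm_apply_apply, ← hc σ, (φ σ).dist_eq,
      f.symm.dist_eq]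
    exact x.2
  { toFun := fun σ =>
      { toFun := fun x => ⟨f (φ σ (f.symm x)), hmem σ x⟩
        invFun := fun x => ⟨f (φ σ⁻¹ (f.symm x)), hmem σ⁻¹ x⟩
        left_inv := fun x => Subtype.ext <| by simp
        right_inv := fun x => Subtype.ext <| by simp
        isometry_toFun := Isometry.of_dist_eq fun x y => by
          rw [Subtype.dist_eq, Subtype.dist_eq, f.dist_eq, (φ σ).dist_eq, f.symm.dist_eq] }
    map_one' := IsometryEquiv.ext fun x => Subtype.ext <| by
      change f (φ 1 (f.symm x)) = x
      simp
    map_mul' := fun σ τ => IsometryEquiv.ext fun x => Subtype.ext <| by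
      change f (φ (σ * τ) (f.symm x)) = f (φ σ (f.symm (f (φ τ (f.symm x)))))
      simp }

theorem sphereRep_apply {H : Type*} [Group H] {U V : Type*} [MetricSpace U] [MetricSpace V]
    (f : U ≃ᵢ V) (φ : H →* (U ≃ᵢ U)) (c : V) (hc : ∀ σ, φ σ (f.symm c) = f.symm c) (r : ℝ)
    (σ : H) (x : Metric.sphere c r) : (sphereRep f φ c hc r σ x : V) = f (φ σ (f.symm x)) := rfl

theorem continuous_sphereRep {H : Type*} [Group H] [TopologicalSpace H] {U V : Type*}
    [MetricSpace U] [MetricSpace V] (f : U ≃ᵢ V) (φ : H →* (U ≃ᵢ U)) (hφ : Continuous φ) (c : V)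
    (hc : ∀ σ, φ σ (f.symm c) = f.symm c) (r : ℝ) : Continuous (sphereRep f φ c hc r) := by
  refine continuous_induced_rng.2 (continuous_pi fun x => Continuous.subtype_mk ?_ _)
  exact f.continuous.comp ((IsometryEquiv.continuous_apply _).comp hφ)

/-- Uniqueness of pointed Urysohn spaces carries the fixed point of the constructed action to the
given centre c; the action then restricts to the sphere. -/
theorem IsUrysohnSpace.hasUnboundedStabilizer_sphere {U : Type} [MetricSpace U]
    (hU : IsUrysohnSpace U) (c : U) {r : ℝ} (hr : 0 < r) :
    HasUnboundedStabilizer (Metric.sphere c r ≃ᵢ Metric.sphere c r) := by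
  obtain ⟨V, _, hV, φ, hφ, c', e, hc', he, hec, hee⟩ := exists_isUrysohnSpace_rep hr
  obtain ⟨f, rfl⟩ := hV.exists_isometryEquiv hU c' c
  have hc : ∀ σ, φ σ (f.symm (f c')) = f.symm (f c') := by simpa using hc'
  have hmem : ∀ n, f (e n) ∈ Metric.sphere (f c') r := fun n => by
    rw [Metric.mem_sphere, f.dist_eq, hec]
  refine hasUnboundedStabilizer_of_perm (sphereRep f φ (f c') hc r)
    (continuous_sphereRep f φ hφ _ hc r) (fun g => g ⟨f (e 0), hmem 0⟩)
    (IsometryEquiv.continuous_apply _) (fun n => ⟨f (e n), hmem n⟩) (fun σ => Subtype.ext ?_) hr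
    fun m n hmn => ?_
  · rw [sphereRep_apply, f.symm_apply_apply, he]
  · beta_reduce
    rw [Subtype.dist_eq, f.dist_eq, hee hmn]

theorem IsUrysohnSpace.polishSpace_sphere {U : Type} [MetricSpace U] (hU : IsUrysohnSpace U)
    (c : U) (r : ℝ) : PolishSpace (Metric.sphere c r ≃ᵢ Metric.sphere c r) := by
  have := hU.complete
  have := hU.separable
  have : CompleteSpace (Metric.sphere c r) := Metric.isClosed_sphere.completeSpace_coe
  have : SecondCountableTopology U := UniformSpace.secondCountable_of_separable U
  exact IsometryEquiv.polishSpace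

/-- A Polish group with an unbounded stabilizer in its left completion. -/
theorem HasUnboundedStabilizer.conclusion {G : Type} [Group G] [TopologicalSpace G]
    [IsTopologicalGroup G] (hP : PolishSpace G) (h : HasUnboundedStabilizer G) :
    PolishSpace G ∧ HasNoncompactStabilizer G ∧ NoProperOrFreeIsometricAction.{0, v} G ∧
      NoProperOrFreeAffineIsometricAction.{0, v} G :=
  ⟨hP, h.hasNoncompactStabilizer, h.noProperOrFreeIsometricAction,
    h.noProperOrFreeIsometricAction.affine⟩

theorem mainTheorem3 :
    -- the unitary group of `ℓ²`
    (PolishSpace UnitaryEllTwo ∧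
      HasNoncompactStabilizer UnitaryEllTwo ∧
      NoProperOrFreeIsometricAction.{0, v} UnitaryEllTwo ∧
      NoProperOrFreeAffineIsometricAction.{0, v} UnitaryEllTwo) ∧
    -- the infinite symmetric group
    (PolishSpace (Equiv.Perm ℕ) ∧
      HasNoncompactStabilizer (Equiv.Perm ℕ) ∧
      NoProperOrFreeIsometricAction.{0, v} (Equiv.Perm ℕ) ∧
      NoProperOrFreeAffineIsometricAction.{0, v} (Equiv.Perm ℕ)) ∧
    -- the isometry group of a sphere in the Urysohn space
    ((∃ (U : Type) (_ : MetricSpace U), IsUrysohnSpace U) ∧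
      ∀ (U : Type) [MetricSpace U], IsUrysohnSpace U → ∀ (c : U) (r : ℝ), 0 < r →
        (PolishSpace (Metric.sphere c r ≃ᵢ Metric.sphere c r) ∧
          HasNoncompactStabilizer (Metric.sphere c r ≃ᵢ Metric.sphere c r) ∧
          NoProperOrFreeIsometricAction.{0, v} (Metric.sphere c r ≃ᵢ Metric.sphere c r) ∧
          NoProperOrFreeAffineIsometricAction.{0, v}
            (Metric.sphere c r ≃ᵢ Metric.sphere c r))) ∧
    -- the group of endpoint-preserving homeomorphisms of the unit interval
    (PolishSpace HomeoPlus ∧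
      HasNoncompactStabilizer HomeoPlus ∧
      NoProperOrFreeIsometricAction.{0, v} HomeoPlus ∧
      NoProperOrFreeAffineIsometricAction.{0, v} HomeoPlus) := by
  refine ⟨UnitaryEllTwo.hasUnboundedStabilizer.conclusion UnitaryEllTwo.polishSpace,
    SInfty.hasUnboundedStabilizer.conclusion SInfty.polishSpace, ⟨?_, fun U _ hU c r hr =>
      (hU.hasUnboundedStabilizer_sphere c hr).conclusion (hU.polishSpace_sphere c r)⟩,
    HomeoPlus.hasUnboundedStabilizer.conclusion HomeoPlus.polishSpace⟩
  obtain ⟨U, m, hU, -⟩ := exists_isUrysohnSpace_rep one_pos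
  exact ⟨U, m, hU⟩
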